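/- Theorem 1.1. There is an absolute constant $K>0$ with the following property. Let $B>0$ be real, let $\mathbb F_q$ be a finite field, and let $n\ge 1$ be $B$-smooth (every prime factor of $n$ is at most $B$). For polynomials $b_e$ that form a basis of $\mathbb F_q[x]_{<n}$ and a finite set $P\subseteq\mathbb F_q$, say that *the FFT for $(b_e)$ at $P$ costs at most $T$* if a single straight-line program with at most $T$ field operations ($+,-,\cdot,/$ in $\mathbb F_q$) computes all values $f(\alpha)$, $\alpha\in P$, of $f=\sum_e a_e b_e\in\mathbb F_q[x]_{<n}$ from the coefficients $(a_e)$; constants of $\mathbb F_q$ that do not depend on $f$ are precomputed and free. (1) If $n\mid q-1$, then for every $\beta\in\mathbb F_q^*$ the set $P=\{\alpha\in\mathbb F_q:\alpha^n=\beta^n\}$ has $n$ elements, and the FFT for the standard basis $1,x,\dots,x^{n-1}$ at $P$ costs at most $K\,B\,n\log n$. (2) Let $p=\operatorname{char}\mathbb F_q$. If $n\mid q$, then $n=p^r$ for some $r\ge 0$, and there is a chain $W_0\subset W_1\subset\dots\subset W_r$ of additive subgroups of $\mathbb F_q$ with $|W_i|=p^i$ such that, with $\ell_i(x)=\prod_{w\in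 W_i}(x-w)$, the products $\ell_0^{e_0}\cdots\ell_{r-1}^{e_{r-1}}$ $(0\le e_i<p)$ form a basis of $\mathbb F_q[x]_{<n}$, and the FFT for this basis at every coset $P=\gamma+W_r$ (a set of $n$ elements) costs at most $K\,B\,n\log n$. (3) If $n\mid q+1$, then there are a factorization $n=p_1\cdots p_r$ into primes and a primitive polynomial $x^2+ax+b$ over $\mathbb F_q$ (irreducible, with a root that generates $\mathbb F_{q^2}^*$) with the following property. Let $\sigma$ be the automorphism $x\mapsto 1/(-bx-a)$ of $\mathbb F_q(x)$ over $\mathbb F_q$, which has order $q+1$, let $G_i$ be the subgroup of $\langle\sigma\rangle$ of order $p_1\cdots p_i$, and let $x_i=\sum_{\tau\in G_i}\tau(x)$ for $0\le i\le r$. For $0\le i<r$ there is an enumeration $\lambda_{i,1},\dots,\lambda_{i,p_{i+1}-1}$ of distinct elements of $\mathbb F_q$ such that $$x_{i+1}=\frac{u_i(x_i)}{\prod_j (x_i-\lambda_{i,j})}$$ in lowest terms, with a polynomial $u_i$ over $\mathbb F_q$ of degree $p_{i+1}$. Let $z_i^{(e)}=\prod_{j=1}^{e}(x_i-\lambda_{i,j})^{-1}$,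 and let $N\in\mathbb F_q[x]$ be the monic denominator of $x_r$. The functions $N\,z_0^{(e_0)}\cdots z_{r-1}^{(e_{r-1})}$ $(0\le e_i<p_{i+1})$ are polynomials and form a basis of $\mathbb F_q[x]_{<n}$. Moreover there is $Q\in\mathbb F_q\cup\{\infty\}$, with $Q=\infty$ if and only if $n=q+1$, such that the set $\mathcal P=\{\alpha\in\mathbb F_q\cup\{\infty\}: x_r(\alpha)=Q\}$ has exactly $n$ elements, and the FFT for this basis at $P=\mathcal P\cap\mathbb F_q$ costs at most $K\,B\,n\log n$. (If $n<q+1$, then $\mathcal P\subseteq\mathbb F_q$, so that $P=\mathcal P$. If $n=q+1$, then $\mathcal P=\mathbb F_q\cup\{\infty\}$, and the value at $\infty$, which is $\infty$ by convention, is not computed.) -/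

import Mathlib

open Polynomial

namespace GFFT

/-! ## Arithmetic straight-line programs over a field

The cost model counts field operations.  The inputs of a program are indexed by `ι`; every
intermediate result is a function of the input vector.  Constants of the field (values that depend
only on the field, the basis and the evaluation set, but not on the input) are free. -/

/-- The quantities that can be an operand, or an output, once the intermediate results listed
in `L` have been computed: an input, a constant, or an earlier result. -/
inductive Available {F ι : Type*} (L : List ((ι → F) → F)) : ((ι → F) → F) → Prop
  | input (i : ι) : Available L (fun a => a i)
  | const (c : F) : Available L (fun _ => c)
  | prev {g : (ι → F) → F} (hg : g ∈ L) : Available L g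

/-- `IsStraightLine L`: the list `L` (latest result first) is the list of results of a straight-line
program, each step of which performs one operation `+`, `-`, `*`, `/` on two available quantities.
A division is allowed only if its divisor vanishes for no input. The number of operations
is the length of `L`. -/
inductive IsStraightLine {F ι : Type*} [Field F] : List ((ι → F) → F) → Prop
  | nil : IsStraightLine []
  | add {L : List ((ι → F) → F)} {u v : (ι → F) → F} (hL : IsStraightLine L)
      (hu : Available L u) (hv : Available L v) : IsStraightLine ((fun a => u a + v a) :: L)
  | sub {L : List ((ι → F) → F)} {u v : (ι → F) → F} (hL : IsStraightLine L)
      (hu : Available L u) (hv : Available L v) : IsStraightLine ((fun a => u a - v a) :: L)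
  | mul {L : List ((ι → F) → F)} {u v : (ι → F) → F} (hL : IsStraightLine L)
      (hu : Available L u) (hv : Available L v) : IsStraightLine ((fun a => u a * v a) :: L)
  | div {L : List ((ι → F) → F)} {u v : (ι → F) → F} (hL : IsStraightLine L)
      (hu : Available L u) (hv : Available L v) (hne : ∀ a, v a ≠ 0) :
      IsStraightLine ((fun a => u a / v a) :: L)

/-- `EvalCostLE b P T`: some straight-line program with at most `T` field operations has as outputs,
for every coefficient vector `a`, the values `f(α)`, `α ∈ P`, of the polynomial `f = ∑ e, a e • b e`.
One and the same program serves all `a`. -/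
def EvalCostLE {F ι : Type*} [Field F] [Fintype ι] (b : ι → F[X]) (P : Finset F) (T : ℝ) : Prop :=
  ∃ L : List ((ι → F) → F), IsStraightLine L ∧ (L.length : ℝ) ≤ T ∧
    ∀ α ∈ P, Available L (fun a => (∑ e, a e • b e).eval α)

/-- The family `b` consists of polynomials of degree `< n` and is a basis of the space `F[x]_{<n}`
of all these polynomials. -/
def IsBasisDegreeLT {F ι : Type*} [Field F] (n : ℕ) (b : ι → F[X]) : Prop :=
  ∃ B : Module.Basis ι F (degreeLT F n), ∀ e, ((B e : degreeLT F n) : F[X]) = b e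

/-- `n` is `B`-smooth: every prime factor of `n` is at most the real number `B`. -/
def IsSmooth (B : ℝ) (n : ℕ) : Prop :=
  n ≠ 0 ∧ ∀ l : ℕ, l.Prime → l ∣ n → (l : ℝ) ≤ B

/-! ## Multiplicative case -/

open Classical in
/-- The set of solutions of `x ^ n = β ^ n`. If `n ∣ q - 1` and `β ≠ 0`, it is the coset of `β`
modulo the group of `n`-th roots of unity. -/
noncomputable def rootCoset (F : Type*) [Field F] [Fintype F] (n : ℕ) (β : F) : Finset F :=
  Finset.univ.filter (fun x => x ^ n = β ^ n)

/-! ## Additive case -/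

open Classical in
/-- The linearized polynomial `∏_{w ∈ W} (x - w)` of an additive subgroup `W` of a finite field. -/
noncomputable def linearized {F : Type*} [Field F] [Fintype F] (W : AddSubgroup F) : F[X] :=
  ∏ w ∈ Finset.univ.filter (fun w => w ∈ W), (X - C w)

open Classical in
/-- The coset `γ + W`. -/
noncomputable def addCoset {F : Type*} [Field F] [Fintype F] (W : AddSubgroup F) (γ : F) :
    Finset F :=
  Finset.univ.filter (fun x => x - γ ∈ W)

/-- A chain `W 0 ⊂ W 1 ⊂ ⋯ ⊂ W r` of additive subgroups (that is, of subspaces over the prime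
field) of a field of characteristic `p`, with `|W i| = p ^ i`. -/
def IsAddChain {F : Type*} [Field F] {r : ℕ} (W : Fin (r + 1) → AddSubgroup F) : Prop :=
  Monotone W ∧ ∀ i, Nat.card (W i) = ringChar F ^ (i : ℕ)

/-- The products `ℓ_0 ^ e_0 ⋯ ℓ_{r-1} ^ e_{r-1}`, `0 ≤ e_i < p`, of the linearized polynomials
`ℓ_i` of the members of the chain `W`. -/
noncomputable def addBasis {F : Type*} [Field F] [Fintype F] {r : ℕ}
    (W : Fin (r + 1) → AddSubgroup F) (e : Fin r → Fin (ringChar F)) : F[X] :=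
  ∏ i : Fin r, linearized (W i.castSucc) ^ (e i : ℕ)

/-! ## The case of a cyclic group of order dividing `q + 1` -/

/-- `x ^ 2 + a x + b` is irreducible, and primitive: the residue class of `x` generates the
multiplicative group, of order `q ^ 2 - 1`, of `F[x]/(x ^ 2 + a x + b)`. -/
def IsPrimitiveQuadratic {F : Type*} [Field F] [Fintype F] (a b : F) : Prop :=
  Irreducible (X ^ 2 + C a * X + C b : F[X]) ∧
    orderOf (AdjoinRoot.root (X ^ 2 + C a * X + C b : F[X])) = Fintype.card F ^ 2 - 1

/-- The image `(A₀₀ x + A₀₁) / (A₁₀ x + A₁₁)` of `x` under the automorphism of `F(x)` that the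
matrix `A` induces. -/
noncomputable def mobius {F : Type*} [Field F] (A : Matrix (Fin 2) (Fin 2) F) : RatFunc F :=
  (RatFunc.C (A 0 0) * RatFunc.X + RatFunc.C (A 0 1)) /
    (RatFunc.C (A 1 0) * RatFunc.X + RatFunc.C (A 1 1))

/-- The matrix of the automorphism `σ`, of order `q + 1` in the projective linear group when
`x ^ 2 + a x + b` is primitive. -/
def sigma {F : Type*} [Field F] (a b : F) : Matrix (Fin 2) (Fin 2) F := !![0, 1; -b, -a]

/-- The trace `∑_{τ ∈ G} τ(x)` of `x` for the subgroup `G` of order `m` of `⟨σ⟩`, where `m ∣ q + 1`;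
the members of `G` are the powers `σ ^ (k (q + 1) / m)`, `0 ≤ k < m`. It generates the fixed field
of `G`. -/
noncomputable def traceGen {F : Type*} [Field F] [Fintype F] (a b : F) (m : ℕ) : RatFunc F :=
  ∑ k ∈ Finset.range m, mobius (sigma a b ^ (k * ((Fintype.card F + 1) / m)))

/-- The product `p_1 ⋯ p_i` of the first `i` of the numbers `p_1, …, p_r`. -/
def partialProd {r : ℕ} (p : Fin r → ℕ) (i : ℕ) : ℕ :=
  ∏ j ∈ Finset.univ.filter (fun j : Fin r => (j : ℕ) < i), p j

/-- The generator `x_i = ∑_{τ ∈ G_i} τ(x)` of the fixed field of the subgroup `G_i` of `⟨σ⟩` of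
order `p_1 ⋯ p_i`. -/
noncomputable def towerGen {F : Type*} [Field F] [Fintype F] (a b : F) {r : ℕ} (p : Fin r → ℕ)
    (i : ℕ) : RatFunc F :=
  traceGen a b (partialProd p i)

/-- For each `i`, the family `lam i` enumerates the `p_{i+1} - 1` distinct `λ ∈ F` such that the
place `x_i = λ` lies above the pole of `x_{i+1}`: the generator `x_{i+1}` is, in lowest terms,
`u(x_i) / ∏_j (x_i - λ_j)` with a polynomial `u` of degree `p_{i+1}`. -/
def IsPoleEnumeration {F : Type*} [Field F] [Fintype F] (a b : F) {r : ℕ} (p : Fin r → ℕ)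
    (lam : (i : Fin r) → Fin (p i - 1) → F) : Prop :=
  ∀ i : Fin r, Function.Injective (lam i) ∧
    ∃ u : F[X], u.natDegree = p i ∧ (∀ j, u.eval (lam i j) ≠ 0) ∧
      towerGen a b p (i + 1) =
        aeval (towerGen a b p i) u / ∏ j, (towerGen a b p i - RatFunc.C (lam i j))

/-- The function `z_i^(e) = 1 / ((x_i - λ_{i,1}) ⋯ (x_i - λ_{i,e}))`, where `0 ≤ e < p_{i+1}`. -/
noncomputable def poleProd {F : Type*} [Field F] [Fintype F] (a b : F) {r : ℕ} (p : Fin r → ℕ)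
    (lam : (i : Fin r) → Fin (p i - 1) → F) (i : Fin r) (e : ℕ) : RatFunc F :=
  (∏ j ∈ Finset.univ.filter (fun j : Fin (p i - 1) => (j : ℕ) < e),
    (towerGen a b p i - RatFunc.C (lam i j)))⁻¹

/-- `bas e = N · z_0^(e_0) ⋯ z_{r-1}^(e_{r-1})` for all `e`, where `N` is the monic denominator
of `x_r`, that is, the product of the `x - α` over all finite poles `α` of `x_r`. -/
def IsCyclicBasis {F : Type*} [Field F] [Fintype F] (a b : F) {r : ℕ} (p : Fin r → ℕ)
    (lam : (i : Fin r) → Fin (p i - 1) → F) (bas : ((i : Fin r) → Fin (p i)) → F[X]) : Prop :=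
  ∀ e, algebraMap F[X] (RatFunc F) (bas e) =
    algebraMap F[X] (RatFunc F) (towerGen a b p r).denom *
      ∏ i : Fin r, poleProd a b p lam i (e i)

open Classical in
/-- The value of the rational function `g` at a rational place of `F(x)`. The rational places are
the elements of `F` and the pole `∞` of `x`; the value is `∞` at the poles of `g`. -/
noncomputable def placeValue {F : Type*} [Field F] (g : RatFunc F) : OnePoint F → OnePoint F
  | none => if g.denom.natDegree < g.num.natDegree then OnePoint.infty
      else ((g.num.coeff g.denom.natDegree : F) : OnePoint F)
  | some α => if g.denom.eval α = 0 then OnePoint.infty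
      else ((g.num.eval α / g.denom.eval α : F) : OnePoint F)

/-- The set of rational places of `F(x)` that lie above the rational place `Q` of the
subfield `F(g)`. -/
def placesAbove {F : Type*} [Field F] (g : RatFunc F) (Q : OnePoint F) : Set (OnePoint F) :=
  {R | placeValue g R = Q}

open Classical in
/-- The finite places in a set of rational places, as elements of the field. -/
noncomputable def finitePoints {F : Type*} [Field F] [Fintype F] (S : Set (OnePoint F)) :
    Finset F :=
  Finset.univ.filter (fun α => (α : OnePoint F) ∈ S)

end GFFT

/-!
All three transforms are instances of one scheme. Each basis function, restricted to the evaluation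
set `P`, is a product of `r` factors, one for every digit of its index, and the factors of index at
least `j` depend only on the image of the point under a map `π_j` with at most `n / (p_1 ⋯ p_j)`
values on `P` (up to a scalar that depends on the point alone). Summing over the digits from the
last to the first, one meets at each stage at most `n` linear forms, each of them a combination of
as many forms of the stage before as the digit has values; this takes `O(n (p_1 + ⋯ + p_r))` operations
(`evalCostLE_of_tower`), which is `O(B n log n)` because `r ≤ log₂ n` (`cost_le`). In the
multiplicative case `π_j` is the power map with exponent `p_1 ⋯ p_j`, and in the additive case it
is the reduction modulo the subgroup `W_j`.

In the cyclic case let `θ`, `θ'` be the fixed points of `σ` in the quadratic extension `K` of `F`.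
The coordinate `y = (x - θ) / (x - θ')` identifies the projective line over `F` with the group of
`(q + 1)`-th roots of unity in `K` and turns `σ` into a multiplication by a generator of this
group. Since `x = θ' + (θ - θ') / (1 - y)`, the identity `∑ 1 / (1 - ζ y) = m / (1 - y ^ m)`, with
`ζ` running through the `m`-th roots of unity, gives the trace over the subgroup of order `m` in
closed form: it is `m` times the function `g_m` whose coordinate is `y ^ m`
(`PrimitivePair.traceGen_eq`). Here `g_m = H_m / E_m`, where the polynomials `H_m` and `E_m` over
`F` are given by `(x - θ) ^ m = H_m - θ E_m`. So the tower of the generators is, in the coordinate,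
a tower of power maps; this yields its poles, the relation between consecutive generators
(`PrimitivePair.exists_gen_mul_eq`), the fibres over the rational places
(`PrimitivePair.placeValue_gen_eq_iff`) and the factorization of the values of the basis functions
(`PrimitivePair.eval_levelPoly`), with `π_j` the power map of the coordinate. The basis functions
are linearly independent because each level contributes polynomials in the coordinate of this
level, of degree less than `p_j`, that vanish to different orders at `1`
(`PrimitivePair.linearIndependent_basisPoly`).
-/

namespace GFFT

/-! ### Straight-line programs -/

theorem Available.mono {F ι : Type*} {L L' : List ((ι → F) → F)} (h : L ⊆ L')
    {g : (ι → F) → F} (hg : Available L g) : Available L' g := by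
  cases hg with
  | input i => exact .input i
  | const c => exact .const c
  | prev hg => exact .prev (h hg)

/-- A linear combination of `k` available quantities with constant coefficients costs at most `2 k`
further operations. -/
theorem IsStraightLine.exists_linearCombination {F ι : Type*} [Field F]
    {L : List ((ι → F) → F)} (hL : IsStraightLine L) (k : ℕ) (c : Fin k → F)
    (h : Fin k → (ι → F) → F) (hh : ∀ x, Available L (h x)) :
    ∃ L', IsStraightLine L' ∧ L ⊆ L' ∧ L'.length ≤ L.length + 2 * k ∧
      Available L' (fun a => ∑ x, c x * h x a) := by
  induction k with
  | zero => exact ⟨L, hL, List.Subset.refl L, by simp, by simpa using Available.const 0⟩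
  | succ k ih =>
    obtain ⟨L', hL', hs, hl, ha⟩ := ih (fun x => c x.castSucc) (fun x => h x.castSucc)
      (fun x => hh _)
    have h1 := hL'.mul (.const (c (Fin.last k))) ((hh (Fin.last k)).mono hs)
    have h2 := h1.add (ha.mono (List.subset_cons_self _ _)) (.prev List.mem_cons_self)
    refine ⟨_, h2, fun g hg => List.mem_cons_of_mem _ (List.mem_cons_of_mem _ (hs hg)),
      by simp only [List.length_cons]; omega, ?_⟩
    simp only [Fin.sum_univ_castSucc]
    exact .prev List.mem_cons_self

/-- A finite set of linear combinations, each of `k` available quantities, costs at most `2 k`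
further operations per member of the set. -/
theorem IsStraightLine.exists_linearCombinations {F ι : Type*} [Field F]
    {L : List ((ι → F) → F)} (hL : IsStraightLine L) (k : ℕ) (S : Finset ((ι → F) → F))
    (hS : ∀ g ∈ S, ∃ (c : Fin k → F) (h : Fin k → (ι → F) → F),
      (∀ x, Available L (h x)) ∧ g = fun a => ∑ x, c x * h x a) :
    ∃ L', IsStraightLine L' ∧ L ⊆ L' ∧ L'.length ≤ L.length + S.card * (2 * k) ∧
      ∀ g ∈ S, Available L' g := by
  classical
  induction S using Finset.induction_on with
  | empty => exact ⟨L, hL, List.Subset.refl L, by simp, by simp⟩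
  | insert g S hg ih =>
    obtain ⟨L', hL', hs, hl, ha⟩ := ih fun g hg => hS g (Finset.mem_insert_of_mem hg)
    obtain ⟨c, h, hh, rfl⟩ := hS g (Finset.mem_insert_self _ _)
    obtain ⟨L'', hL'', hs', hl', ha'⟩ :=
      hL'.exists_linearCombination k c h (fun x => (hh x).mono hs)
    refine ⟨L'', hL'', List.Subset.trans hs hs', ?_, ?_⟩
    · rw [Finset.card_insert_of_notMem hg, add_mul, one_mul]
      omega
    · intro g' hg'
      rcases Finset.mem_insert.1 hg' with rfl | hg'
      · exact ha'
      · exact (ha g' hg').mono hs'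

/-! ### Products of initial segments -/

theorem partialProd_zero {r : ℕ} (p : Fin r → ℕ) : partialProd p 0 = 1 := by
  simp [partialProd]

theorem partialProd_succ {r : ℕ} (p : Fin r → ℕ) (i : Fin r) :
    partialProd p (i + 1) = partialProd p i * p i := by
  unfold partialProd
  have : Finset.univ.filter (fun j : Fin r => (j : ℕ) < i + 1) =
      insert i (Finset.univ.filter (fun j : Fin r => (j : ℕ) < i)) := by
    ext j
    simp only [Finset.mem_filter, Finset.mem_univ, true_and, Finset.mem_insert, Fin.ext_iff]
    omega
  rw [this, Finset.prod_insert (by simp), mul_comm]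

theorem partialProd_last {r : ℕ} (p : Fin r → ℕ) : partialProd p r = ∏ i, p i := by
  simp [partialProd]

theorem partialProd_dvd {r : ℕ} (p : Fin r → ℕ) (i : ℕ) : partialProd p i ∣ ∏ i, p i :=
  Finset.prod_dvd_prod_of_subset _ _ _ (Finset.filter_subset _ _)

/-! ### The fast Fourier transform along a tower -/

section Tower

variable {F ι : Type*} [Field F] [Fintype ι] {r : ℕ} {p : Fin r → ℕ}

open Classical in
/-- The partial sum computed at stage `j` of the transform: the inputs whose first `j` digits are
those of `e`, weighted by the factors of index at least `j`, at the point `α`. -/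
noncomputable def stage {A : Type*} (d : ι → (i : Fin r) → Fin (p i))
    (fac : (i : Fin r) → Fin (p i) → A → F) (j : ℕ) (e : (i : Fin r) → Fin (p i)) (α : A) :
    (ι → F) → F :=
  fun a => ∑ k ∈ Finset.univ.filter (fun k => ∀ i : Fin r, (i : ℕ) < j → d k i = e i),
    a k * ∏ i ∈ Finset.univ.filter (fun i : Fin r => j ≤ (i : ℕ)), fac i (d k i) α

/-- Sorting the inputs by the digit `j` expresses a form of stage `j` by forms of stage `j + 1`. -/
theorem stage_step {A : Type*} (d : ι → (i : Fin r) → Fin (p i))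
    (fac : (i : Fin r) → Fin (p i) → A → F) (j : Fin r) (e : (i : Fin r) → Fin (p i)) (α : A) :
    stage d fac j e α = fun a => ∑ x : Fin (p j), fac j x α *
      stage d fac (j + 1) (Function.update e j x) α a := by
  classical
  funext a
  have hprod : Finset.univ.filter (fun i : Fin r => (j : ℕ) ≤ i) =
      insert j (Finset.univ.filter (fun i : Fin r => (j : ℕ) + 1 ≤ i)) := by
    ext i
    simp only [Finset.mem_filter, Finset.mem_univ, true_and, Finset.mem_insert, Fin.ext_iff]
    omega
  unfold stage
  rw [← Finset.sum_fiberwise_of_maps_to (t := Finset.univ) (g := fun k => d k j)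
    (fun _ _ => Finset.mem_univ _)]
  refine Finset.sum_congr rfl fun x _ => ?_
  rw [Finset.mul_sum, Finset.filter_filter]
  refine Finset.sum_congr ?_ fun k hk => ?_
  · ext k
    simp only [Finset.mem_filter, Finset.mem_univ, true_and]
    constructor
    · rintro ⟨h1, h2⟩ i hi
      by_cases hij : i = j
      · subst hij; simpa using h2
      · rw [Function.update_of_ne hij]
        exact h1 i (by have : (i : ℕ) ≠ j := fun h => hij (Fin.ext h); omega)
    · intro h
      refine ⟨fun i hi => ?_, by simpa using h j (by omega)⟩
      have hij : i ≠ j := by rintro rfl; omega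
      simpa [Function.update_of_ne hij] using h i (by omega)
  · simp only [Finset.mem_filter, Finset.mem_univ, true_and] at hk
    have hx : d k j = x := by simpa using hk j (by omega)
    rw [hprod, Finset.prod_insert (by simp), hx]
    ring

theorem stage_congr {A : Type*} (d : ι → (i : Fin r) → Fin (p i))
    (fac : (i : Fin r) → Fin (p i) → A → F) (j : ℕ) {e e' : (i : Fin r) → Fin (p i)} {α β : A}
    (he : ∀ i : Fin r, (i : ℕ) < j → e i = e' i)
    (hfac : ∀ i : Fin r, j ≤ (i : ℕ) → ∀ x, fac i x α = fac i x β) :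
    stage d fac j e α = stage d fac j e' β := by
  classical
  funext a
  unfold stage
  refine Finset.sum_congr ?_ fun k _ => ?_
  · ext k
    simp only [Finset.mem_filter, Finset.mem_univ, true_and]
    exact ⟨fun h i hi => (h i hi).trans (he i hi), fun h i hi => (h i hi).trans (he i hi).symm⟩
  · congr 1
    exact Finset.prod_congr rfl fun i hi => hfac i (Finset.mem_filter.1 hi).2 _

/-- If `f` factors through `g` on `s`, it takes at most as many values there. -/
theorem card_image_le_of_factor {X Y Z : Type*} [DecidableEq Y] [DecidableEq Z] (s : Finset X)
    (f : X → Y) (g : X → Z) (h : ∀ a ∈ s, ∀ b ∈ s, g a = g b → f a = f b) :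
    (s.image f).card ≤ (s.image g).card := by
  classical
  have hc : ∀ y ∈ s.image f, ∃ x ∈ s, f x = y := fun y hy => by simpa using hy
  rcases isEmpty_or_nonempty X with hX | hX
  · simp [Finset.eq_empty_of_isEmpty s]
  choose! c hc1 hc2 using hc
  refine Finset.card_le_card_of_injOn (fun y => g (c y))
    (fun y hy => Finset.mem_image_of_mem _ (hc1 y hy)) fun y hy z hz hyz => ?_
  rw [← hc2 y hy, ← hc2 z hz]
  exact h _ (hc1 y hy) _ (hc1 z hz) hyz

/-- The number of different linear forms at stage `j` is at most the number of digit prefixes of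
length `j` times the number of classes of points at level `j`. -/
theorem card_stage_le {A : Type*} {S : Fin r → Type*} (d : ι → (i : Fin r) → Fin (p i))
    (fac : (i : Fin r) → Fin (p i) → A → F) (P : Finset A) (π : (j : Fin r) → A → S j)
    [∀ j, DecidableEq (S j)] [DecidableEq ((ι → F) → F)]
    (hfac : ∀ i j : Fin r, j ≤ i → ∀ α ∈ P, ∀ β ∈ P, π j α = π j β → ∀ x, fac i x α = fac i x β)
    (j : Fin r) :
    ((Finset.univ ×ˢ P).image fun ea => stage d fac j ea.1 ea.2).card ≤
      partialProd p j * (P.image (π j)).card := by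
  classical
  let g : ((i : Fin r) → Fin (p i)) × A → ((i : {i : Fin r // (i : ℕ) < j}) → Fin (p i)) × S j :=
    fun ea => (fun i => ea.1 i, π j ea.2)
  calc _ ≤ ((Finset.univ ×ˢ P).image g).card := by
        refine card_image_le_of_factor _ _ _ fun a ha b hb hab => ?_
        simp only [g, Prod.mk.injEq, funext_iff, Subtype.forall] at hab
        exact stage_congr d fac j hab.1 fun i hi =>
          hfac i j hi _ (Finset.mem_product.1 ha).2 _ (Finset.mem_product.1 hb).2 hab.2
    _ ≤ (Finset.univ ×ˢ P.image (π j) :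
          Finset (((i : {i : Fin r // (i : ℕ) < j}) → Fin (p i)) × S j)).card := by
        refine Finset.card_le_card fun x hx => ?_
        obtain ⟨ea, hea, rfl⟩ := Finset.mem_image.1 hx
        exact Finset.mem_product.2 ⟨Finset.mem_univ _,
          Finset.mem_image_of_mem _ (Finset.mem_product.1 hea).2⟩
    _ = _ := by
        rw [Finset.card_product, Finset.card_univ, Fintype.card_pi]
        simp only [Fintype.card_fin]
        congr 1
        unfold partialProd
        exact (Finset.prod_subtype _ (by simp) p).symm

/-- The program of the fast Fourier transform, run backwards from stage `r` (the inputs). -/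
theorem exists_stage_program {A : Type*} {S : Fin r → Type*}
    (d : ι ≃ ((i : Fin r) → Fin (p i)))
    (fac : (i : Fin r) → Fin (p i) → A → F) (P : Finset A) (π : (j : Fin r) → A → S j)
    [∀ j, DecidableEq (S j)] (n : ℕ)
    (hfac : ∀ i j : Fin r, j ≤ i → ∀ α ∈ P, ∀ β ∈ P, π j α = π j β → ∀ x, fac i x α = fac i x β)
    (hcard : ∀ j : Fin r, partialProd p j * (P.image (π j)).card ≤ n) (k : ℕ) (hk : k ≤ r) :
    ∃ L : List ((ι → F) → F), IsStraightLine L ∧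
      L.length ≤ 2 * n * ∑ i ∈ Finset.univ.filter (fun i : Fin r => r - k ≤ (i : ℕ)), p i ∧
      ∀ e, ∀ α ∈ P, Available L (stage d fac (r - k) e α) := by
  classical
  induction k with
  | zero =>
    refine ⟨[], .nil, by simp, fun e α _ => ?_⟩
    have : stage d fac (r - 0) e α = fun a => a (d.symm e) := by
      funext a
      unfold stage
      rw [Finset.sum_eq_single (d.symm e)]
      · rw [Finset.prod_eq_one, mul_one]
        intro i hi
        have := (Finset.mem_filter.1 hi).2
        omega
      · intro k hk hne
        simp only [Finset.mem_filter, Finset.mem_univ, true_and] at hk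
        refine absurd ?_ hne
        rw [Equiv.eq_symm_apply]
        exact funext fun i => hk i (by omega)
      · intro h
        simp at h
    rw [this]
    exact .input _
  | succ k ih =>
    obtain ⟨L, hL, hl, ha⟩ := ih (by omega)
    let j : Fin r := ⟨r - (k + 1), by omega⟩
    have hj : r - k = (j : ℕ) + 1 := by simp only [j]; omega
    obtain ⟨L', hL', hs, hl', ha'⟩ := hL.exists_linearCombinations (p j)
      ((Finset.univ ×ˢ P).image fun ea => stage d fac j ea.1 ea.2) (by
        intro g hg
        obtain ⟨⟨e, α⟩, hea, rfl⟩ := Finset.mem_image.1 hg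
        refine ⟨fun x => fac j x α, fun x => stage d fac (j + 1) (Function.update e j x) α,
          fun x => ?_, stage_step _ _ _ _ _⟩
        rw [← hj]
        exact ha _ _ (Finset.mem_product.1 hea).2)
    refine ⟨L', hL', hl'.trans ?_, fun e α hα => ?_⟩
    · have hc := (card_stage_le d fac P π hfac j).trans (hcard j)
      have : Finset.univ.filter (fun i : Fin r => r - (k + 1) ≤ (i : ℕ)) =
          insert j (Finset.univ.filter (fun i : Fin r => r - k ≤ (i : ℕ))) := by
        ext i
        simp only [Finset.mem_filter, Finset.mem_univ, true_and, Finset.mem_insert, Fin.ext_iff, j]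
        omega
      rw [this, Finset.sum_insert (by simp [j]; omega)]
      nlinarith [Nat.mul_le_mul_right (2 * p j) hc]
    · exact ha' _ (Finset.mem_image.2 ⟨(e, α), Finset.mem_product.2 ⟨Finset.mem_univ _, hα⟩, rfl⟩)

/-- The fast Fourier transform along a tower. The values at the points of `P` of the basis
functions are, up to a factor `c` depending on the point only, products of `r` factors, one for each
digit of the index, and the factors of index `i ≥ j` depend on the class `π j α` of the point only.
If the number of classes at level `j` is at most `n / (p_1 ⋯ p_j)`, the transform takes at most
`3 n (p_1 + ⋯ + p_r)` operations. -/
theorem evalCostLE_of_tower {S : Fin r → Type*} (d : ι ≃ ((i : Fin r) → Fin (p i)))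
    (b : ι → F[X]) (P : Finset F) (π : (j : Fin r) → F → S j)
    (fac : (i : Fin r) → Fin (p i) → F → F) (c : F → F) [∀ j, DecidableEq (S j)] (n : ℕ)
    (hb : ∀ k, ∀ α ∈ P, (b k).eval α = c α * ∏ i, fac i (d k i) α)
    (hc : r = 0 → ∀ α ∈ P, c α = 1)
    (hfac : ∀ i j : Fin r, j ≤ i → ∀ α ∈ P, ∀ β ∈ P, π j α = π j β → ∀ x, fac i x α = fac i x β)
    (hcard : ∀ j : Fin r, partialProd p j * (P.image (π j)).card ≤ n)
    (hP : P.card ≤ n) (hp : ∀ i, 2 ≤ p i) {T : ℝ} (hT : 3 * n * ∑ i, (p i : ℝ) ≤ T) :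
    EvalCostLE b P T := by
  classical
  obtain ⟨L, hL, hl, ha⟩ := exists_stage_program d fac P π n hfac hcard r le_rfl
  simp only [Nat.sub_self, zero_le, Finset.filter_true] at hl ha
  have hval : ∀ e, ∀ α ∈ P, (fun a : ι → F => (∑ k, a k • b k).eval α) =
      fun a => c α * stage d fac 0 e α a := by
    intro e α hα
    funext a
    simp only [stage, eval_finsetSum, eval_smul, smul_eq_mul, Finset.mul_sum]
    refine Finset.sum_congr (by simp) fun k _ => ?_
    rw [hb k α hα]
    simp only [zero_le, Finset.filter_true]
    ring
  let e : (i : Fin r) → Fin (p i) := fun i => ⟨0, zero_lt_two.trans_le (hp i)⟩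
  rcases Nat.eq_zero_or_pos r with hr | hr
  · refine ⟨L, hL, le_trans ?_ hT, fun α hα => ?_⟩
    · subst hr
      simp only [Finset.univ_eq_empty, Finset.sum_empty, mul_zero, nonpos_iff_eq_zero] at hl
      simp [hl]
    · rw [hval e α hα]
      simpa [hc hr α hα] using ha e α hα
  · obtain ⟨L', hL', hs, hl', ha'⟩ := hL.exists_linearCombinations 1
      (P.image fun α => (fun a : ι → F => (∑ k, a k • b k).eval α)) (by
        intro g hg
        obtain ⟨α, hα, rfl⟩ := Finset.mem_image.1 hg
        refine ⟨fun _ => c α, fun _ => stage d fac 0 e α, fun _ => ha e α hα, ?_⟩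
        simp [hval e α hα])
    refine ⟨L', hL', le_trans ?_ hT, fun α hα => ha' _ (Finset.mem_image_of_mem _ hα)⟩
    have hsum : 2 ≤ ∑ i, p i :=
      (hp ⟨0, hr⟩).trans (Finset.single_le_sum (fun i _ => Nat.zero_le (p i)) (Finset.mem_univ _))
    have hlen : L'.length ≤ 3 * n * ∑ i, p i := by
      have := (Finset.card_image_le (s := P)
        (f := fun α => (fun a : ι → F => (∑ k, a k • b k).eval α))).trans hP
      nlinarith [Nat.mul_le_mul_left n hsum]
    exact_mod_cast hlen

end Tower

/-! ### Prime factorizations and the cost bound -/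

theorem exists_prime_family {n : ℕ} (hn : n ≠ 0) :
    ∃ (r : ℕ) (p : Fin r → ℕ), (∀ i, (p i).Prime) ∧ ∏ i, p i = n := by
  refine ⟨n.primeFactorsList.length, fun i => n.primeFactorsList.get i,
    fun i => Nat.prime_of_mem_primeFactorsList (List.get_mem _ i), ?_⟩
  rw [← List.prod_ofFn, List.ofFn_get, Nat.prod_primeFactorsList hn]

/-- The number `r` of prime factors is at most `log n / log 2`. The constant `5` is an upper bound
for `3 / log 2`. -/
theorem cost_le {B : ℝ} {n r : ℕ} {p : Fin r → ℕ} (hB : 0 < B) (hn : IsSmooth B n)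
    (hp : ∀ i, (p i).Prime) (hpn : ∏ i, p i = n) :
    3 * (n : ℝ) * ∑ i, (p i : ℝ) ≤ 5 * (B * n * Real.log n) := by
  have hsum : ∑ i, (p i : ℝ) ≤ r * B := by
    calc ∑ i, (p i : ℝ) ≤ ∑ _i : Fin r, B :=
          Finset.sum_le_sum fun i _ => hn.2 _ (hp i)
            (hpn ▸ Finset.dvd_prod_of_mem p (Finset.mem_univ i))
      _ = r * B := by simp
  have hpow : 2 ^ r ≤ n := by
    rw [← hpn]
    calc 2 ^ r = ∏ _i : Fin r, 2 := by simp
      _ ≤ _ := Finset.prod_le_prod' fun i _ => (hp i).two_le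
  have hlog : r * Real.log 2 ≤ Real.log n := by
    rw [← Real.log_pow]
    exact Real.log_le_log (by positivity) (by exact_mod_cast hpow)
  have h2 : (0.6931471803 : ℝ) < Real.log 2 := Real.log_two_gt_d9
  have hr : 3 * (r : ℝ) ≤ 5 * Real.log n := by
    have : (0 : ℝ) ≤ r := Nat.cast_nonneg r
    nlinarith
  calc 3 * (n : ℝ) * ∑ i, (p i : ℝ) ≤ 3 * n * (r * B) := by gcongr
    _ = (3 * r) * (B * n) := by ring
    _ ≤ (5 * Real.log n) * (B * n) := by gcongr
    _ = _ := by ring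

/-! ### Bases of the space of polynomials of bounded degree -/

theorem isBasisDegreeLT_of_linearIndependent {F ι : Type*} [Field F] [Fintype ι] [Nonempty ι]
    {n : ℕ} {b : ι → F[X]} (hb : LinearIndependent F b) (hdeg : ∀ e, (b e).degree < n)
    (hcard : Fintype.card ι = n) : IsBasisDegreeLT n b := by
  let b' : ι → degreeLT F n := fun e => ⟨b e, mem_degreeLT.2 (hdeg e)⟩
  have hb' : LinearIndependent F b' :=
    LinearIndependent.of_comp (Submodule.subtype _) hb
  have hfin : Module.finrank F (degreeLT F n) = n := by
    simpa using Module.finrank_eq_card_basis (degreeLT.basis F n)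
  refine ⟨basisOfLinearIndependentOfCardEqFinrank hb' (hcard.trans hfin.symm), fun e => ?_⟩
  simp [b']

theorem linearIndependent_of_degree_injective {F ι : Type*} [Field F] [Fintype ι] {b : ι → F[X]}
    (hb : ∀ e, b e ≠ 0) (hinj : Function.Injective fun e => (b e).natDegree) :
    LinearIndependent F b := by
  rw [Fintype.linearIndependent_iff]
  intro g hg i
  by_contra hi
  have hd := degree_sum_eq_of_disjoint (fun e => g e • b e) Finset.univ (by
    rintro x ⟨-, hx⟩ y ⟨-, hy⟩ hxy h
    have hgx : g x ≠ 0 := fun h0 => hx (by simp [h0])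
    have hgy : g y ≠ 0 := fun h0 => hy (by simp [h0])
    simp only [Function.comp_apply, smul_eq_C_mul, degree_C_mul hgx, degree_C_mul hgy] at h
    exact hxy (hinj (natDegree_eq_of_degree_eq h)))
  rw [hg, degree_zero, eq_comm, Finset.sup_eq_bot_iff] at hd
  have := hd i (Finset.mem_univ i)
  rw [degree_eq_bot, smul_eq_zero] at this
  exact this.elim hi (hb i)

/-! ### The multiplicative case -/

theorem prod_castLE {r : ℕ} (p : Fin r → ℕ) (i : Fin r) :
    ∏ j : Fin i, p (Fin.castLE i.is_lt.le j) = partialProd p i := by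
  unfold partialProd
  refine Finset.prod_bij (fun j _ => Fin.castLE i.is_lt.le j) (fun j _ => by
    exact Finset.mem_filter.2 ⟨Finset.mem_univ _, j.2⟩)
    (fun a _ b _ h => Fin.castLE_injective _ h) (fun j hj => ?_) fun _ _ => rfl
  exact ⟨⟨j, (Finset.mem_filter.1 hj).2⟩, Finset.mem_univ _, Fin.ext rfl⟩

theorem partialProd_dvd_partialProd {r : ℕ} (p : Fin r → ℕ) {i j : ℕ} (h : j ≤ i) :
    partialProd p j ∣ partialProd p i :=
  Finset.prod_dvd_prod_of_subset _ _ _ fun l hl => by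
    simp only [Finset.mem_filter, Finset.mem_univ, true_and] at hl ⊢
    exact hl.trans_le h

/-- The map `y ↦ y ^ m` is `m` to one on the solutions of `y ^ n = t`. -/
theorem mul_card_image_pow_le {A K : Type*} [Field K] [DecidableEq K] {P : Finset A} {Y : A → K}
    {n m : ℕ} (hn : 0 < n) (hm : m ∣ n) {t : K} (hY : ∀ α ∈ P, Y α ^ n = t) :
    m * (P.image fun α => Y α ^ m).card ≤ n := by
  obtain ⟨k, rfl⟩ := hm
  have hk : 0 < k := Nat.pos_of_mul_pos_left hn
  refine Nat.mul_le_mul_left m ?_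
  calc _ ≤ (nthRoots k t).toFinset.card := by
        refine Finset.card_le_card fun y hy => ?_
        obtain ⟨α, hα, rfl⟩ := Finset.mem_image.1 hy
        rw [Multiset.mem_toFinset, mem_nthRoots hk, ← pow_mul, hY α hα]
    _ ≤ _ := (Multiset.toFinset_card_le _).trans (card_nthRoots k t)

theorem card_rootCoset {F : Type*} [Field F] [Fintype F] {n : ℕ} (hn : 0 < n)
    (h : n ∣ Fintype.card F - 1) {β : F} (hβ : β ≠ 0) : (rootCoset F n β).card = n := by
  classical
  obtain ⟨g, hg⟩ := IsCyclic.exists_ofOrder_eq_natCard (α := Fˣ)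
  have hprim : IsPrimitiveRoot (g : F) (Fintype.card F - 1) := by
    rw [IsPrimitiveRoot.coe_units_iff, ← Fintype.card_units, ← Nat.card_eq_fintype_card, ← hg]
    exact IsPrimitiveRoot.orderOf g
  obtain ⟨k, hk⟩ := h
  have hpos : 0 < Fintype.card F - 1 := Nat.sub_pos_of_lt Fintype.one_lt_card
  have hprim' := hprim.pow hpos (by rw [hk, mul_comm] : Fintype.card F - 1 = k * n)
  have hnodup : (nthRoots n (β ^ n)).Nodup := hprim'.nthRoots_nodup (pow_ne_zero n hβ)
  have hset : rootCoset F n β = (nthRoots n (β ^ n)).toFinset := by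
    ext x
    simp [rootCoset, mem_nthRoots hn]
  rw [hset, Multiset.toFinset_card_of_nodup hnodup, hprim'.card_nthRoots, if_pos ⟨β, rfl⟩]

theorem multiplicative_case {F : Type*} [Field F] [Fintype F] {B : ℝ} {n : ℕ} (hB : 0 < B)
    (hn : IsSmooth B n) :
    IsBasisDegreeLT n (fun i : Fin n => (X ^ (i : ℕ) : F[X])) ∧
      ∀ β : F, EvalCostLE (fun i : Fin n => (X ^ (i : ℕ) : F[X])) (rootCoset F n β)
        (5 * (B * n * Real.log n)) := by
  classical
  refine ⟨⟨degreeLT.basis F n, fun e => by simp⟩, fun β => ?_⟩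
  have hn0 : 0 < n := Nat.pos_of_ne_zero hn.1
  obtain ⟨r, p, hp, hpn⟩ := exists_prime_family hn.1
  have hroot : ∀ α ∈ rootCoset F n β, α ^ n = β ^ n := fun α hα => by simpa [rootCoset] using hα
  have hcount : ∀ m, m ∣ n → m * ((rootCoset F n β).image fun α => α ^ m).card ≤ n :=
    fun m hm => mul_card_image_pow_le (Y := id) hn0 hm hroot
  refine evalCostLE_of_tower ((finCongr hpn.symm).trans finPiFinEquiv.symm) _ _
    (fun (j : Fin r) α => α ^ partialProd p j) (fun i e α => (α ^ partialProd p i) ^ (e : ℕ))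
    (fun _ => 1) n ?_ (fun _ _ _ => rfl) ?_ (fun j => hcount _ (hpn ▸ partialProd_dvd p j)) ?_
    (fun i => (hp i).two_le) (cost_le hB hn hp hpn)
  · intro k α _
    have hk : (k : ℕ) = finPiFinEquiv (finPiFinEquiv.symm (finCongr hpn.symm k)) := by simp
    rw [eval_pow, eval_X, one_mul, hk, finPiFinEquiv_apply, ← Finset.prod_pow_eq_pow_sum]
    refine Finset.prod_congr rfl fun i _ => ?_
    rw [prod_castLE, mul_comm, pow_mul]
    rfl
  · intro i j hij α _ β _ h x
    obtain ⟨k, hk⟩ := partialProd_dvd_partialProd p hij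
    rw [hk, pow_mul, pow_mul, h]
  · simpa using hcount 1 (one_dvd n)

/-! ### The additive case -/

theorem exists_addChain (F : Type*) [Field F] [Fintype F] {r : ℕ}
    (hr : ringChar F ^ r ∣ Fintype.card F) :
    ∃ W : Fin (r + 1) → AddSubgroup F, IsAddChain W := by
  have hp : Fact (ringChar F).Prime := ⟨CharP.char_is_prime F _⟩
  suffices H : ∀ k ≤ r, ∃ W : ℕ → AddSubgroup F, Monotone W ∧
      ∀ i ≤ k, Nat.card (W i) = ringChar F ^ i by
    obtain ⟨W, hW, hc⟩ := H r le_rfl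
    exact ⟨fun i => W i, fun i j hij => hW hij, fun i => hc i (Nat.lt_succ_iff.1 i.2)⟩
  intro k
  induction k with
  | zero => exact fun _ => ⟨fun _ => ⊥, monotone_const, fun i hi => by simp_all⟩
  | succ k ih =>
    intro hk
    obtain ⟨W, hW, hc⟩ := ih (by omega)
    obtain ⟨V, hV, hle⟩ := Sylow.exists_subgroup_card_pow_succ (G := Multiplicative F)
      (p := ringChar F) (n := k) (H := AddSubgroup.toSubgroup (W k))
      ((pow_dvd_pow _ hk).trans (by simpa [Nat.card_eq_fintype_card] using hr)) (hc k le_rfl)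
    let V' : AddSubgroup F := AddSubgroup.toSubgroup.symm V
    have hWV : W k ≤ V' := fun x hx => hle (show Multiplicative.ofAdd x ∈ _ from hx)
    refine ⟨fun i => if i ≤ k then W i else V', fun i j hij => ?_, fun i hi => ?_⟩
    · dsimp only
      split_ifs with h1 h2 h2
      · exact hW hij
      · exact (hW h1).trans hWV
      · omega
      · exact le_rfl
    · dsimp only
      split_ifs with h
      · exact hc i h
      · obtain rfl : i = k + 1 := by omega
        exact hV

theorem linearized_ne_zero {F : Type*} [Field F] [Fintype F] (W : AddSubgroup F) :
    linearized W ≠ 0 :=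
  (monic_prod_of_monic _ _ fun w _ => monic_X_sub_C w).ne_zero

theorem natDegree_linearized {F : Type*} [Field F] [Fintype F] (W : AddSubgroup F) :
    (linearized W).natDegree = Nat.card W := by
  classical
  unfold linearized
  rw [natDegree_prod_of_monic _ _ fun w _ => monic_X_sub_C w]
  simp only [natDegree_X_sub_C, Finset.sum_const, smul_eq_mul, mul_one]
  rw [Nat.card_eq_fintype_card]
  exact (Fintype.card_subtype fun w => w ∈ W).symm

theorem linearized_eval_congr {F : Type*} [Field F] [Fintype F] (W : AddSubgroup F) {α β : F}
    (h : (α : F ⧸ W) = β) : (linearized W).eval α = (linearized W).eval β := by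
  classical
  have h' : -α + β ∈ W := QuotientAddGroup.eq.1 h
  unfold linearized
  simp only [eval_prod, eval_sub, eval_X, eval_C]
  refine Finset.prod_bij (fun w _ => w + (-α + β)) ?_ ?_ ?_ ?_
  · intro w hw
    simpa using W.add_mem (by simpa using hw) h'
  · intro a _ b _ hab
    simpa using hab
  · intro b hb
    exact ⟨b - (-α + β), by simpa using W.sub_mem (by simpa using hb) h', by simp⟩
  · intro w _
    ring

theorem card_addCoset {F : Type*} [Field F] [Fintype F] (W : AddSubgroup F) (γ : F) :
    (addCoset W γ).card = Nat.card W := by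
  classical
  rw [Nat.card_eq_fintype_card, Fintype.card_subtype]
  refine Finset.card_bij (fun x _ => x - γ) (by simp [addCoset]) (by simp) fun b hb => ?_
  exact ⟨b + γ, by simpa [addCoset] using hb, by simp⟩

/-- A coset of `V` is the union of `|V| / |W|` cosets of the subgroup `W`. -/
theorem card_mul_card_image_mk_le {F : Type*} [Field F] [Fintype F] {W V : AddSubgroup F}
    (hWV : W ≤ V) (γ : F) [DecidableEq (F ⧸ W)] :
    Nat.card W * ((addCoset V γ).image fun α : F => (α : F ⧸ W)).card ≤ Nat.card V := by
  classical
  rw [← card_addCoset V γ, Finset.card_eq_sum_card_image (fun α : F => (α : F ⧸ W)) (addCoset V γ),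
    mul_comm, ← smul_eq_mul]
  refine Finset.card_nsmul_le_sum _ _ _ fun y hy => ?_
  obtain ⟨α, hα, rfl⟩ := Finset.mem_image.1 hy
  rw [← card_addCoset W α]
  refine Finset.card_le_card fun β hβ => ?_
  simp only [addCoset, Finset.mem_filter, Finset.mem_univ, true_and] at hα hβ ⊢
  refine ⟨by simpa using V.add_mem (hWV hβ) hα, ?_⟩
  rw [eq_comm, QuotientAddGroup.eq]
  simpa [add_comm, sub_eq_add_neg] using hβ

theorem additive_case {F : Type*} [Field F] [Fintype F] {B : ℝ} {n : ℕ} (hB : 0 < B)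
    (hn : IsSmooth B n) (hq : n ∣ Fintype.card F) :
    ∃ (r : ℕ) (W : Fin (r + 1) → AddSubgroup F),
      n = ringChar F ^ r ∧ IsAddChain W ∧ IsBasisDegreeLT n (addBasis W) ∧
      ∀ γ : F, (addCoset (W (Fin.last r)) γ).card = n ∧
        EvalCostLE (addBasis W) (addCoset (W (Fin.last r)) γ) (5 * (B * n * Real.log n)) := by
  classical
  have hp : (ringChar F).Prime := CharP.char_is_prime F _
  obtain ⟨d, -, hd⟩ := FiniteField.card F (ringChar F)
  obtain ⟨r, -, rfl⟩ := (Nat.dvd_prime_pow hp).1 (hd ▸ hq)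
  obtain ⟨W, hW⟩ := exists_addChain F hq
  have hprod : ∏ _i : Fin r, ringChar F = ringChar F ^ r := by simp
  have hpp : ∀ i : Fin r, partialProd (fun _ : Fin r => ringChar F) i = ringChar F ^ (i : ℕ) := by
    intro i
    rw [← prod_castLE]
    simp
  have hmonic : ∀ e, addBasis W e ≠ 0 := fun e =>
    Finset.prod_ne_zero_iff.2 fun i _ => pow_ne_zero _ (linearized_ne_zero _)
  -- The degrees are the numbers with base `p` digits `e`.
  have hdeg : ∀ e, (addBasis W e).natDegree = finFunctionFinEquiv e := by
    intro e
    unfold addBasis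
    rw [natDegree_prod _ _ fun i _ => pow_ne_zero _ (linearized_ne_zero _),
      finFunctionFinEquiv_apply]
    refine Finset.sum_congr rfl fun i _ => ?_
    rw [natDegree_pow, natDegree_linearized, hW.2]
    rfl
  have : NeZero (ringChar F) := ⟨hp.ne_zero⟩
  refine ⟨r, W, rfl, hW, ?_, fun γ => ⟨?_, ?_⟩⟩
  · refine isBasisDegreeLT_of_linearIndependent
      (linearIndependent_of_degree_injective hmonic fun e e' h => ?_) (fun e => ?_) (by simp)
    · simp only [hdeg] at h
      exact finFunctionFinEquiv.injective (Fin.ext h)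
    · rw [degree_eq_natDegree (hmonic e), hdeg]
      exact_mod_cast (finFunctionFinEquiv e).2
  · rw [card_addCoset, hW.2, Fin.val_last]
  · refine evalCostLE_of_tower (p := fun _ => ringChar F) (Equiv.refl _) _ _
      (fun (j : Fin r) α => (α : F ⧸ W j.castSucc))
      (fun i e α => (linearized (W i.castSucc)).eval α ^ (e : ℕ))
      (fun _ => 1) (ringChar F ^ r)
      ?_ (fun _ _ _ => rfl) ?_ ?_ ?_ (fun i => hp.two_le) (cost_le hB hn (fun _ => hp) hprod)
    · intro k α _
      simp [addBasis, eval_prod]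
    · intro i j hij α _ β _ h x
      have hle : W j.castSucc ≤ W i.castSucc := hW.1 (Fin.castSucc_le_castSucc_iff.2 hij)
      rw [linearized_eval_congr (W i.castSucc)
        (QuotientAddGroup.eq.2 (hle (QuotientAddGroup.eq.1 h)))]
    · intro j
      have := card_mul_card_image_mk_le (hW.1 (Fin.le_last j.castSucc)) γ
      rwa [hW.2, hW.2, Fin.val_last, Fin.val_castSucc, ← hpp] at this
    · rw [card_addCoset, hW.2, Fin.val_last]

/-! ### The powers of `x - θ` -/

/-- The polynomials `H_m`, `E_m` over `F`, as a pair, with `(x - θ) ^ m = H_m - θ E_m` for each of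
the roots `θ` of `x ^ 2 - s x + c`. -/
noncomputable def powPair {F : Type*} [Field F] (s c : F) : ℕ → F[X] × F[X]
  | 0 => (1, 0)
  | m + 1 => (X * (powPair s c m).1 - C c * (powPair s c m).2,
      (powPair s c m).1 + (X - C s) * (powPair s c m).2)

/-- The polynomial `H_m` of degree `m` with `(x - θ) ^ m = H_m - θ E_m`. -/
noncomputable def powH {F : Type*} [Field F] (s c : F) (m : ℕ) : F[X] := (powPair s c m).1

/-- The polynomial `E_m` of degree `m - 1` with `(x - θ) ^ m = H_m - θ E_m`. -/
noncomputable def powE {F : Type*} [Field F] (s c : F) (m : ℕ) : F[X] := (powPair s c m).2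

section

variable {F : Type*} [Field F] (s c : F)

@[simp] theorem powH_zero : powH s c 0 = 1 := rfl

@[simp] theorem powE_zero : powE s c 0 = 0 := rfl

theorem powH_succ (m : ℕ) : powH s c (m + 1) = X * powH s c m - C c * powE s c m := rfl

theorem powE_succ (m : ℕ) : powE s c (m + 1) = powH s c m + (X - C s) * powE s c m := rfl

@[simp] theorem powH_one : powH s c 1 = X := by simp [powH_succ]

@[simp] theorem powE_one : powE s c 1 = 1 := by simp [powE_succ]

theorem pow_sub_eq {R : Type*} [CommRing R] (ψ : F[X] →+* R) {θ : R}
    (hθ : θ ^ 2 = ψ (C s) * θ - ψ (C c)) (m : ℕ) :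
    (ψ X - θ) ^ m = ψ (powH s c m) - θ * ψ (powE s c m) := by
  induction m with
  | zero => simp
  | succ m ih =>
    rw [pow_succ, ih, powH_succ, powE_succ]
    simp only [map_sub, map_mul, map_add]
    linear_combination ψ (powE s c m) * hθ

theorem powH_powE_degree (m : ℕ) :
    (powH s c (m + 1)).Monic ∧ (powH s c (m + 1)).natDegree = m + 1 ∧
      (powE s c (m + 1)).degree ≤ m ∧ (powE s c (m + 1)).coeff m = (m + 1 : ℕ) := by
  induction m with
  | zero => simp [monic_X]
  | succ m ih =>
    obtain ⟨h1, h2, h3, h4⟩ := ih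
    have h3' : (powE s c (m + 1)).natDegree ≤ m := natDegree_le_of_degree_le h3
    have hX : (X * powH s c (m + 1)).Monic := monic_X.mul h1
    have hXd : (X * powH s c (m + 1)).natDegree = m + 2 := by
      rw [monic_X.natDegree_mul h1, h2, natDegree_X]; omega
    have hlt : (C c * powE s c (m + 1)).degree < (X * powH s c (m + 1)).degree := by
      refine degree_lt_degree (lt_of_le_of_lt (natDegree_C_mul_le _ _) ?_)
      omega
    refine ⟨?_, ?_, ?_, ?_⟩
    · rw [powH_succ]
      exact hX.sub_of_left hlt
    · rw [powH_succ, natDegree_sub_eq_left_of_natDegree_lt, hXd]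
      rw [hXd]
      exact lt_of_le_of_lt (natDegree_C_mul_le _ _) (by omega)
    · rw [powE_succ]
      refine (degree_le_of_natDegree_le ?_)
      refine natDegree_add_le_of_degree_le h2.le
        (natDegree_mul_le_of_le (natDegree_X_sub_C_le s) h3' |>.trans (by omega))
    · rw [powE_succ, sub_mul, coeff_add, coeff_sub, coeff_X_mul, h4, coeff_C_mul,
        coeff_eq_zero_of_natDegree_lt (show (powE s c (m + 1)).natDegree < m + 1 by omega)]
      have := h1.coeff_natDegree
      rw [h2] at this
      rw [this]
      push_cast
      ring

theorem natDegree_powH (m : ℕ) : (powH s c m).natDegree = m := by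
  cases m with
  | zero => simp
  | succ m => exact (powH_powE_degree s c m).2.1

theorem natDegree_powE_le (m : ℕ) : (powE s c m).natDegree ≤ m - 1 := by
  cases m with
  | zero => simp
  | succ m => exact natDegree_le_of_degree_le (powH_powE_degree s c m).2.2.1

theorem natDegree_powE {m : ℕ} (hm : (m : F) ≠ 0) : (powE s c m).natDegree = m - 1 := by
  cases m with
  | zero => simp at hm
  | succ m =>
    refine le_antisymm (natDegree_powE_le s c _) (le_natDegree_of_ne_zero ?_)
    rw [Nat.add_sub_cancel, (powH_powE_degree s c m).2.2.2]
    exact hm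

theorem leadingCoeff_powE {m : ℕ} (hm : (m : F) ≠ 0) : (powE s c m).leadingCoeff = m := by
  rw [leadingCoeff, natDegree_powE s c hm]
  cases m with
  | zero => simp at hm
  | succ m => exact (powH_powE_degree s c m).2.2.2

theorem powE_ne_zero {m : ℕ} (hm : (m : F) ≠ 0) : powE s c m ≠ 0 := by
  rw [← leadingCoeff_ne_zero, leadingCoeff_powE s c hm]
  exact hm

end

section

variable {F L : Type*} [Field F] [Field L] {s c : F}

theorem sub_mul_powE (ψ : F[X] →+* L) {θ θ' : L} (hs : θ + θ' = ψ (C s)) (hc : θ * θ' = ψ (C c))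
    (m : ℕ) : (θ - θ') * ψ (powE s c m) = (ψ X - θ') ^ m - (ψ X - θ) ^ m := by
  rw [pow_sub_eq s c ψ (θ := θ) (by rw [← hs, ← hc]; ring),
    pow_sub_eq s c ψ (θ := θ') (by rw [← hs, ← hc]; ring)]
  ring

theorem sub_mul_powH (ψ : F[X] →+* L) {θ θ' : L} (hs : θ + θ' = ψ (C s)) (hc : θ * θ' = ψ (C c))
    (m : ℕ) : (θ - θ') * ψ (powH s c m) = θ * (ψ X - θ') ^ m - θ' * (ψ X - θ) ^ m := by
  rw [pow_sub_eq s c ψ (θ := θ) (by rw [← hs, ← hc]; ring),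
    pow_sub_eq s c ψ (θ := θ') (by rw [← hs, ← hc]; ring)]
  ring

/-- The function `g_m = H_m / E_m` is the power map in the coordinate `(x - θ) / (x - θ')`, so that
`g_{m k} = H_k(g_m) / E_k(g_m)`; here `ψ₂` is the substitution of `g_m` for `x`. -/
theorem powE_mul (ψ₁ ψ₂ : F[X] →+* L) (hψ : ∀ a, ψ₁ (C a) = ψ₂ (C a)) {θ θ' : L}
    (hs : θ + θ' = ψ₁ (C s)) (hc : θ * θ' = ψ₁ (C c)) (hne : θ ≠ θ') {m : ℕ}
    (hg : ψ₂ X * ψ₁ (powE s c m) = ψ₁ (powH s c m)) (k : ℕ) :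
    ψ₁ (powE s c (m * k)) = ψ₂ (powE s c k) * ψ₁ (powE s c m) ^ k ∧
      ψ₁ (powH s c (m * k)) = ψ₂ (powH s c k) * ψ₁ (powE s c m) ^ k := by
  have h : ∀ η : L, η ^ 2 = ψ₁ (C s) * η - ψ₁ (C c) →
      (ψ₁ X - η) ^ (m * k) = (ψ₂ X - η) ^ k * ψ₁ (powE s c m) ^ k := by
    intro η hη
    rw [pow_mul, pow_sub_eq s c ψ₁ hη, ← mul_pow, sub_mul, hg]
  have h1 := h θ (by rw [← hs, ← hc]; ring)
  have h2 := h θ' (by rw [← hs, ← hc]; ring)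
  have hd : θ - θ' ≠ 0 := sub_ne_zero.2 hne
  constructor <;> refine mul_left_cancel₀ hd ?_
  · rw [sub_mul_powE ψ₁ hs hc, ← mul_assoc, sub_mul_powE ψ₂ (hs.trans (hψ _)) (hc.trans (hψ _)),
      h1, h2]
    ring
  · rw [sub_mul_powH ψ₁ hs hc, ← mul_assoc, sub_mul_powH ψ₂ (hs.trans (hψ _)) (hc.trans (hψ _)),
      h1, h2]
    ring

theorem isCoprime_powH_powE [Algebra F L] {θ θ' : L} (hs : θ + θ' = algebraMap F L s)
    (hc : θ * θ' = algebraMap F L c) (hne : θ ≠ θ') (m : ℕ) :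
    IsCoprime (powH s c m) (powE s c m) := by
  rw [← isCoprime_map (algebraMap F L)]
  have h : IsCoprime ((X - C θ : L[X]) ^ m) ((X - C θ') ^ m) :=
    (isCoprime_X_sub_C_of_isUnit_sub (sub_ne_zero.2 hne).isUnit).pow
  have key : ∀ η : L, η ^ 2 = algebraMap F L s * η - algebraMap F L c →
      (X - C η : L[X]) ^ m =
        (powH s c m).map (algebraMap F L) - C η * (powE s c m).map (algebraMap F L) := by
    intro η hη
    have := pow_sub_eq s c (mapRingHom (algebraMap F L)) (θ := C η) (by
      rw [← C_pow, hη]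
      simp) m
    simpa using this
  rw [key θ (by rw [← hs, ← hc]; ring), key θ' (by rw [← hs, ← hc]; ring)] at h
  obtain ⟨u, v, huv⟩ := h
  exact ⟨u + v, -(u * C θ + v * C θ'), by linear_combination huv⟩

end

/-! ### The traces in the diagonalizing coordinate -/

/-- Expand `1 / (1 - w) = (1 + w + ⋯ + w ^ (m - 1)) / (1 - w ^ m)` with `w = ζ ^ k y` and sum over
`k`: the powers of `ζ` other than `ζ ^ 0` cancel. -/
theorem sum_inv_one_sub_mul {L : Type*} [Field L] {m : ℕ} (hm : 0 < m) {ζ y : L}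
    (hζ : IsPrimitiveRoot ζ m) (hy : y ^ m ≠ 1) :
    ∑ k ∈ Finset.range m, (1 - ζ ^ k * y)⁻¹ = m * (1 - y ^ m)⁻¹ := by
  have hy' : 1 - y ^ m ≠ 0 := sub_ne_zero.2 hy.symm
  have hw : ∀ k, (ζ ^ k * y) ^ m = y ^ m := fun k => by
    rw [mul_pow, ← pow_mul, mul_comm k, pow_mul, hζ.pow_eq_one, one_pow, one_mul]
  have hw1 : ∀ k, 1 - ζ ^ k * y ≠ 0 := fun k h => hy (by
    rw [← hw k, ← sub_eq_zero.1 h, one_pow])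
  have h1 : ∀ k, (1 - ζ ^ k * y)⁻¹ =
      (∑ j ∈ Finset.range m, y ^ j * (ζ ^ j) ^ k) * (1 - y ^ m)⁻¹ := by
    intro k
    have := mul_neg_geom_sum (ζ ^ k * y) m
    rw [hw] at this
    have h2 : ∑ j ∈ Finset.range m, y ^ j * (ζ ^ j) ^ k =
        ∑ j ∈ Finset.range m, (ζ ^ k * y) ^ j :=
      Finset.sum_congr rfl fun j _ => by rw [mul_pow, ← pow_mul, ← pow_mul]; ring
    rw [h2, ← this, mul_inv, mul_comm (1 - ζ ^ k * y)⁻¹, ← mul_assoc, mul_inv_cancel₀, one_mul]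
    intro h0
    rw [h0, mul_zero] at this
    exact hy' this.symm
  simp_rw [h1]
  rw [← Finset.sum_mul, Finset.sum_comm]
  congr 1
  simp_rw [← Finset.mul_sum]
  rw [Finset.sum_eq_single 0 (fun j hj hj0 => ?_) (by simp [hm.ne'])]
  · simp
  · have hne : ζ ^ j - 1 ≠ 0 :=
      sub_ne_zero.2 (hζ.pow_ne_one_of_pos_of_lt hj0 (Finset.mem_range.1 hj))
    have := mul_geom_sum (ζ ^ j) m
    rw [← pow_mul, mul_comm j, pow_mul, hζ.pow_eq_one, one_pow, sub_self] at this
    rw [(mul_eq_zero.1 this).resolve_left hne, mul_zero]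

theorem sum_mobius_coord {L : Type*} [Field L] {m : ℕ} (hm : 0 < m) {ζ y θ θ' : L}
    (hζ : IsPrimitiveRoot ζ m) (hy : y ^ m ≠ 1) :
    ∑ k ∈ Finset.range m, (θ - θ' * (ζ ^ k * y)) / (1 - ζ ^ k * y) =
      m * ((θ - θ' * y ^ m) / (1 - y ^ m)) := by
  have hw : ∀ k, 1 - ζ ^ k * y ≠ 0 := fun k h => hy (by
    rw [← one_pow m, sub_eq_zero.1 h, mul_pow, ← pow_mul, mul_comm k, pow_mul, hζ.pow_eq_one,
      one_pow, one_mul])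
  have h : ∀ w : L, 1 - w ≠ 0 → (θ - θ' * w) / (1 - w) = θ' + (θ - θ') * (1 - w)⁻¹ := by
    intro w hw
    field_simp
    ring
  rw [Finset.sum_congr rfl fun k _ => h _ (hw k), Finset.sum_add_distrib, ← Finset.mul_sum,
    sum_inv_one_sub_mul hm hζ hy, h _ (sub_ne_zero.2 hy.symm)]
  simp
  ring

/-- The row `(1, -ρ⁻¹)` is an eigenvector of `σ`. -/
theorem sigma_pow_row {F L : Type*} [Field F] [Field L] (κ : F →+* L) {a b : F} {ρ ρ' : L}
    (ha : ρ + ρ' = -κ a) (hb : ρ * ρ' = κ b) (hρ : ρ ≠ 0) (j : ℕ) :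
    κ ((sigma a b ^ j) 0 0) - ρ⁻¹ * κ ((sigma a b ^ j) 1 0) = ρ' ^ j ∧
      κ ((sigma a b ^ j) 0 1) - ρ⁻¹ * κ ((sigma a b ^ j) 1 1) = -(ρ' ^ j * ρ⁻¹) := by
  have ha' : κ a = -(ρ + ρ') := by rw [ha, neg_neg]
  induction j with
  | zero => simp
  | succ j ih =>
    rw [pow_succ']
    generalize sigma a b ^ j = A at ih
    have h1 : (ρ' ^ j : L) = κ (A 0 0) - ρ⁻¹ * κ (A 1 0) := ih.1.symm
    have h2 : (ρ' ^ j * ρ⁻¹ : L) = -(κ (A 0 1) - ρ⁻¹ * κ (A 1 1)) := by rw [ih.2, neg_neg]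
    constructor
    · simp only [sigma, Matrix.mul_apply, Fin.sum_univ_two, Matrix.of_apply, Matrix.cons_val',
        Matrix.cons_val_zero, Matrix.cons_val_one, Matrix.cons_val_fin_one, map_add, map_mul,
        map_neg, ha', ← hb, pow_succ, h1]
      simp
      field_simp
      ring
    · rw [pow_succ, mul_right_comm, h2]
      simp only [sigma, Matrix.mul_apply, Fin.sum_univ_two, Matrix.of_apply, Matrix.cons_val',
        Matrix.cons_val_zero, Matrix.cons_val_one, Matrix.cons_val_fin_one, map_add, map_mul,
        map_neg, ha', ← hb]
      simp
      field_simp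
      ring

/-- In the coordinate `y = (x - θ) / (x - θ')`, where `θ = ρ⁻¹` and `θ' = ρ'⁻¹` are the fixed points
of `σ`, the automorphism `σ` is the multiplication by `ρ' / ρ`. -/
theorem map_mobius_sigma_pow {F L : Type*} [Field F] [Field L] (φ : RatFunc F →+* L) {a b : F}
    {ρ ρ' : L} (ha : ρ + ρ' = -φ (RatFunc.C a)) (hb : ρ * ρ' = φ (RatFunc.C b)) (hρ : ρ ≠ 0)
    (hρ' : ρ' ≠ 0) (hne : ρ⁻¹ ≠ ρ'⁻¹) (ht' : φ RatFunc.X - ρ'⁻¹ ≠ 0) (j : ℕ) :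
    φ (mobius (sigma a b ^ j)) =
      (ρ⁻¹ - ρ'⁻¹ * ((ρ' / ρ) ^ j * ((φ RatFunc.X - ρ⁻¹) / (φ RatFunc.X - ρ'⁻¹)))) /
        (1 - (ρ' / ρ) ^ j * ((φ RatFunc.X - ρ⁻¹) / (φ RatFunc.X - ρ'⁻¹))) := by
  obtain ⟨h1, h2⟩ := sigma_pow_row (φ.comp RatFunc.C) ha hb hρ j
  obtain ⟨h3, h4⟩ := sigma_pow_row (φ.comp RatFunc.C) (a := a) (b := b) (ρ := ρ') (ρ' := ρ)
    (by rw [add_comm]; exact ha) (by rw [mul_comm]; exact hb) hρ' j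
  simp only [RingHom.comp_apply] at h1 h2 h3 h4
  unfold mobius
  simp only [map_div₀, map_add, map_mul]
  generalize φ RatFunc.X = t at *
  generalize φ (RatFunc.C ((sigma a b ^ j) 0 0)) = A at *
  generalize φ (RatFunc.C ((sigma a b ^ j) 0 1)) = B at *
  generalize φ (RatFunc.C ((sigma a b ^ j) 1 0)) = U at *
  generalize φ (RatFunc.C ((sigma a b ^ j) 1 1)) = V at *
  generalize ρ⁻¹ = θ at *
  generalize ρ'⁻¹ = θ' at *
  have hd : θ - θ' ≠ 0 := sub_ne_zero.2 hne
  have hk : ρ ^ j * (t - θ') ≠ 0 := mul_ne_zero (pow_ne_zero _ hρ) ht'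
  have hw : (ρ' / ρ) ^ j * ((t - θ) / (t - θ')) = (ρ' ^ j * (t - θ)) / (ρ ^ j * (t - θ')) := by
    rw [div_pow, div_mul_div_comm]
  have hnum : (θ - θ') * (A * t + B) = θ * (ρ ^ j * (t - θ')) - θ' * (ρ' ^ j * (t - θ)) := by
    linear_combination θ * t * h3 + θ * h4 - θ' * t * h1 - θ' * h2
  have hden : (θ - θ') * (U * t + V) = ρ ^ j * (t - θ') - ρ' ^ j * (t - θ) := by
    linear_combination t * h3 + h4 - t * h1 - h2
  rw [hw, ← mul_div_mul_left _ _ hd, hnum, hden, ← mul_div_mul_left _ (1 - _) hk]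
  congr 1
  · field_simp
  · field_simp

/-! ### A primitive element of the quadratic extension -/

/-- A primitive quadratic polynomial `x ^ 2 + a x + b` over `F`, together with its roots `ρ`, `ρ'` in
an extension field `K`. -/
structure PrimitivePair (F K : Type*) [Field F] [Fintype F] [Field K] [Algebra F K] where
  /-- the coefficient of `x` -/
  a : F
  /-- the constant coefficient -/
  b : F
  /-- a root -/
  ρ : K
  /-- the conjugate root -/
  ρ' : K
  add_eq : ρ + ρ' = -algebraMap F K a
  mul_eq : ρ * ρ' = algebraMap F K b
  frob : ρ ^ Fintype.card F = ρ'
  prim : IsPrimitiveRoot ρ (Fintype.card F ^ 2 - 1)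

theorem exists_primitivePair (F : Type*) [Field F] [Fintype F] :
    ∃ (K : Type) (_ : Field K) (_ : Algebra F K) (T : PrimitivePair F K),
      IsPrimitiveQuadratic T.a T.b := by
  classical
  have hchar : Fact (ringChar F).Prime := ⟨CharP.char_is_prime F _⟩
  let K := FiniteField.Extension F (ringChar F) 2
  have : Fintype K := Fintype.ofFinite K
  have hcard : Fintype.card K = Fintype.card F ^ 2 := by
    rw [← Nat.card_eq_fintype_card, ← Nat.card_eq_fintype_card]
    exact FiniteField.natCard_extension F (ringChar F) 2
  have hq : 1 < Fintype.card F := Fintype.one_lt_card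
  obtain ⟨g, hg⟩ := IsCyclic.exists_ofOrder_eq_natCard (α := Kˣ)
  have hord : orderOf (g : K) = Fintype.card F ^ 2 - 1 := by
    rw [orderOf_units, hg, Nat.card_eq_fintype_card, Fintype.card_units, hcard]
  have hprim : IsPrimitiveRoot (g : K) (Fintype.card F ^ 2 - 1) := hord ▸ IsPrimitiveRoot.orderOf _
  have hint : IsIntegral F (g : K) := Algebra.IsIntegral.isIntegral _
  have hmem : (g : K) ∉ (algebraMap F K).range := by
    rintro ⟨x, hx⟩
    have hx0 : x ≠ 0 := fun h => g.ne_zero (by rw [← hx, h, map_zero])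
    have h1 : (g : K) ^ (Fintype.card F - 1) = 1 := by
      rw [← hx, ← map_pow, FiniteField.pow_card_sub_one_eq_one x hx0, map_one]
    have := Nat.le_of_dvd (by omega) (hprim.dvd_of_pow_eq_one _ h1)
    have : Fintype.card F < Fintype.card F ^ 2 := by nlinarith
    omega
  have hdeg : (minpoly F (g : K)).natDegree = 2 := by
    refine le_antisymm ?_ ((minpoly.two_le_natDegree_iff hint).2 hmem)
    exact (minpoly.natDegree_le _).trans (FiniteField.finrank_extension F (ringChar F) 2).le
  have hmonic := minpoly.monic hint
  have hpoly : minpoly F (g : K) =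
      X ^ 2 + C ((minpoly F (g : K)).coeff 1) * X + C ((minpoly F (g : K)).coeff 0) := by
    have h2 := hmonic.coeff_natDegree
    rw [hdeg] at h2
    conv_lhs => rw [(minpoly F (g : K)).as_sum_range_C_mul_X_pow, hdeg]
    simp [Finset.sum_range_succ, h2]
    ring
  set a := (minpoly F (g : K)).coeff 1
  set b := (minpoly F (g : K)).coeff 0
  have hroot : (g : K) ^ 2 + algebraMap F K a * g + algebraMap F K b = 0 := by
    have := minpoly.aeval F (g : K)
    rw [hpoly] at this
    simpa using this
  have hroot' : ((g : K) ^ Fintype.card F) ^ 2 + algebraMap F K a * (g : K) ^ Fintype.card F +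
      algebraMap F K b = 0 := by
    have := congrArg (FiniteField.frobeniusAlgHom F K) hroot
    simpa only [map_add, map_mul, map_pow, AlgHom.commutes, map_zero,
      FiniteField.frobeniusAlgHom_apply] using this
  have hne : (g : K) - (g : K) ^ Fintype.card F ≠ 0 := by
    intro h
    have h1 : (g : K) ^ (Fintype.card F - 1) = 1 := by
      refine mul_right_cancel₀ g.ne_zero ?_
      rw [one_mul, ← pow_succ, Nat.sub_add_cancel hq.le, ← sub_eq_zero.1 h]
    have := Nat.le_of_dvd (by omega) (hprim.dvd_of_pow_eq_one _ h1)
    have : Fintype.card F < Fintype.card F ^ 2 := by nlinarith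
    omega
  have hadd : (g : K) + (g : K) ^ Fintype.card F = -algebraMap F K a :=
    mul_left_cancel₀ hne (by linear_combination hroot - hroot')
  refine ⟨K, inferInstance, inferInstance,
    ⟨a, b, g, (g : K) ^ Fintype.card F, hadd, ?_, rfl, hprim⟩,
    hpoly ▸ minpoly.irreducible hint, ?_⟩
  · linear_combination (g : K) * hadd - hroot
  · have hirr : Irreducible (X ^ 2 + C a * X + C b : F[X]) := hpoly ▸ minpoly.irreducible hint
    have : Fact (Irreducible (X ^ 2 + C a * X + C b : F[X])) := ⟨hirr⟩
    have heval : (X ^ 2 + C a * X + C b : F[X]).eval₂ (algebraMap F K) g = 0 := by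
      simpa using hroot
    let f : AdjoinRoot (X ^ 2 + C a * X + C b : F[X]) →+* K :=
      AdjoinRoot.lift (algebraMap F K) g heval
    rw [← orderOf_injective (f : _ →* K) f.injective, ← hord]
    congr 1
    exact AdjoinRoot.lift_root heval

theorem num_denom_of_isCoprime {F : Type*} [Field F] {u v : F[X]} (h : IsCoprime u v)
    (hv : v.Monic) :
    (algebraMap F[X] (RatFunc F) u / algebraMap F[X] (RatFunc F) v).num = u ∧
      (algebraMap F[X] (RatFunc F) u / algebraMap F[X] (RatFunc F) v).denom = v := by
  set x := algebraMap F[X] (RatFunc F) u / algebraMap F[X] (RatFunc F) v with hx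
  have h1 : x.num * v = u * x.denom := (RatFunc.num_mul_eq_mul_denom_iff hv.ne_zero).2 hx
  have h2 : v ∣ x.denom := h.symm.dvd_of_dvd_mul_left ⟨x.num, by rw [← h1, mul_comm]⟩
  have h3 : x.denom = v :=
    eq_of_monic_of_associated x.monic_denom hv
      (associated_of_dvd_dvd (RatFunc.denom_div_dvd u v) h2)
  refine ⟨?_, h3⟩
  rw [h3] at h1
  exact mul_right_cancel₀ hv.ne_zero h1

namespace PrimitivePair

variable {F K : Type*} [Field F] [Fintype F] [Field K] [Algebra F K] (T : PrimitivePair F K)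

/-- One of the fixed points of `σ`. -/
noncomputable def θ : K := T.ρ⁻¹

/-- The other fixed point of `σ`. -/
noncomputable def θ' : K := T.ρ'⁻¹

/-- The trace of `θ`. -/
noncomputable def s : F := -(T.a / T.b)

/-- The norm of `θ`. -/
noncomputable def c : F := T.b⁻¹

/-- The numerator `H_m` of the generator of the fixed field of the subgroup of order `m`. -/
noncomputable def H (m : ℕ) : F[X] := powH T.s T.c m

/-- The denominator `E_m` of the generator of the fixed field of the subgroup of order `m`. -/
noncomputable def E (m : ℕ) : F[X] := powE T.s T.c m

theorem card_sq_sub_one : Fintype.card F ^ 2 - 1 = (Fintype.card F - 1) * (Fintype.card F + 1) := by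
  have : 1 ≤ Fintype.card F := Fintype.card_pos
  obtain ⟨k, hk⟩ := Nat.exists_eq_add_of_le this
  rw [hk, Nat.add_sub_cancel_left]
  refine Nat.sub_eq_of_eq_add ?_
  ring

theorem ρ_ne_zero : T.ρ ≠ 0 := by
  refine T.prim.ne_zero ?_
  rw [card_sq_sub_one]
  have : 1 < Fintype.card F := Fintype.one_lt_card
  exact (Nat.mul_pos (by omega) (by omega)).ne'

theorem ρ'_ne_zero : T.ρ' ≠ 0 := T.frob ▸ pow_ne_zero _ T.ρ_ne_zero

theorem isPrimitiveRoot_div : IsPrimitiveRoot (T.ρ' / T.ρ) (Fintype.card F + 1) := by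
  have hq : 1 < Fintype.card F := Fintype.one_lt_card
  have h : T.ρ' / T.ρ = T.ρ ^ (Fintype.card F - 1) := by
    rw [← T.frob, div_eq_iff T.ρ_ne_zero, ← pow_succ, Nat.sub_add_cancel hq.le]
  rw [h]
  refine T.prim.pow ?_ card_sq_sub_one
  rw [card_sq_sub_one]
  exact Nat.mul_pos (by omega) (by omega)

theorem ρ_ne : T.ρ ≠ T.ρ' := fun h => by
  have h1 := T.isPrimitiveRoot_div
  rw [← h, div_self T.ρ_ne_zero] at h1
  have := h1.unique IsPrimitiveRoot.one
  have := Fintype.card_pos (α := F)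
  omega

theorem θ_ne_zero : T.θ ≠ 0 := inv_ne_zero T.ρ_ne_zero

theorem θ'_ne_zero : T.θ' ≠ 0 := inv_ne_zero T.ρ'_ne_zero

theorem θ_ne : T.θ ≠ T.θ' := fun h => T.ρ_ne (inv_injective h)

theorem θ_add : T.θ + T.θ' = algebraMap F K T.s := by
  have h1 := T.ρ_ne_zero
  have h2 := T.ρ'_ne_zero
  rw [θ, θ', s, map_neg, map_div₀, ← T.mul_eq, ← neg_div, ← T.add_eq]
  field_simp
  ring

theorem θ_mul : T.θ * T.θ' = algebraMap F K T.c := by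
  rw [θ, θ', c, map_inv₀, ← T.mul_eq, mul_inv]

theorem θ_frob : T.θ ^ Fintype.card F = T.θ' := by rw [θ, θ', inv_pow, T.frob]

theorem algebraMap_pow_card (x : F) :
    algebraMap F K x ^ Fintype.card F = algebraMap F K x := by
  rw [← map_pow, FiniteField.pow_card]

theorem θ'_frob : T.θ' ^ Fintype.card F = T.θ := by
  have h : T.θ' = algebraMap F K T.c / T.θ := by
    rw [eq_div_iff T.θ_ne_zero, mul_comm, T.θ_mul]
  rw [h, div_pow, algebraMap_pow_card, T.θ_frob, ← T.θ_mul,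
    mul_div_cancel_right₀ _ T.θ'_ne_zero]

theorem sub_θ_ne_zero (x : F) : algebraMap F K x - T.θ ≠ 0 := fun h => T.θ_ne (by
  rw [← T.θ_frob, ← sub_eq_zero.1 h, algebraMap_pow_card])

theorem sub_θ'_ne_zero (x : F) : algebraMap F K x - T.θ' ≠ 0 := fun h => T.θ_ne (by
  rw [← T.θ'_frob, ← sub_eq_zero.1 h, algebraMap_pow_card])

theorem algebraMap_sub_pow_card (x : F) (y : K) :
    (algebraMap F K x - y) ^ Fintype.card F = algebraMap F K x - y ^ Fintype.card F := by
  have := map_sub (FiniteField.frobeniusAlgHom F K) (algebraMap F K x) y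
  simpa only [FiniteField.frobeniusAlgHom_apply, algebraMap_pow_card] using this

/-! ### The coordinate on the projective line -/

/-- The coordinate `(x - θ) / (x - θ')` of a point of the projective line over `F`. It identifies
the projective line with the group of `(q + 1)`-th roots of unity of `K`. -/
noncomputable def coord : OnePoint F → K
  | none => 1
  | some x => (algebraMap F K x - T.θ) / (algebraMap F K x - T.θ')

theorem coord_infty : T.coord OnePoint.infty = 1 := rfl

theorem coord_coe (x : F) :
    T.coord (x : OnePoint F) = (algebraMap F K x - T.θ) / (algebraMap F K x - T.θ') := rfl

theorem coord_coe_ne_one (x : F) : T.coord (x : OnePoint F) ≠ 1 := by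
  rw [coord_coe, Ne, div_eq_one_iff_eq (T.sub_θ'_ne_zero x)]
  exact fun h => T.θ_ne (sub_right_injective h)

theorem coord_injective : Function.Injective T.coord := by
  intro R R' h
  induction R using OnePoint.rec with
  | infty =>
    induction R' using OnePoint.rec with
    | infty => rfl
    | coe x => exact absurd h.symm (T.coord_coe_ne_one x)
  | coe x =>
    induction R' using OnePoint.rec with
    | infty => exact absurd h (T.coord_coe_ne_one x)
    | coe y =>
      rw [coord_coe, coord_coe, div_eq_div_iff (T.sub_θ'_ne_zero x) (T.sub_θ'_ne_zero y)] at h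
      have h1 : (T.θ - T.θ') * (algebraMap F K x - algebraMap F K y) = 0 := by
        linear_combination h
      have h2 := (mul_eq_zero.1 h1).resolve_left (sub_ne_zero.2 T.θ_ne)
      rw [(algebraMap F K).injective (sub_eq_zero.1 h2)]

theorem coord_pow (R : OnePoint F) : T.coord R ^ (Fintype.card F + 1) = 1 := by
  induction R using OnePoint.rec with
  | infty => exact one_pow _
  | coe x =>
    rw [pow_succ, coord_coe, div_pow, algebraMap_sub_pow_card, algebraMap_sub_pow_card, T.θ_frob,
      T.θ'_frob, div_mul_div_comm, mul_comm, div_self]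
    exact mul_ne_zero (T.sub_θ_ne_zero x) (T.sub_θ'_ne_zero x)

/-- The coordinate is onto, since the projective line has `q + 1` points. -/
theorem exists_coord_eq {y : K} (hy : y ^ (Fintype.card F + 1) = 1) : ∃ R, T.coord R = y := by
  classical
  have : Fintype (OnePoint F) := inferInstanceAs (Fintype (Option F))
  have hcard : Fintype.card (OnePoint F) = Fintype.card F + 1 := by
    rw [← Nat.card_eq_fintype_card, ← Nat.card_eq_fintype_card]
    exact Finite.card_option
  have hsub : (Finset.univ.image T.coord) ⊆ nthRootsFinset (Fintype.card F + 1) 1 := by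
    intro z hz
    obtain ⟨R, -, rfl⟩ := Finset.mem_image.1 hz
    exact (mem_nthRootsFinset (Nat.succ_pos _) _).2 (T.coord_pow R)
  have heq := Finset.eq_of_subset_of_card_le hsub (by
    rw [T.isPrimitiveRoot_div.card_nthRootsFinset,
      Finset.card_image_of_injective _ T.coord_injective,
      Finset.card_univ, hcard])
  have hy' : y ∈ nthRootsFinset (Fintype.card F + 1) (1 : K) :=
    (mem_nthRootsFinset (Nat.succ_pos _) _).2 hy
  rw [← heq] at hy'
  simpa using hy'

theorem exists_isPrimitiveRoot (T : PrimitivePair F K) {m : ℕ} (hm : m ∣ Fintype.card F + 1) :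
    ∃ ζ : K, IsPrimitiveRoot ζ m := by
  obtain ⟨k, hk⟩ := hm
  exact ⟨_, T.isPrimitiveRoot_div.pow (Nat.succ_pos _) (hk.trans (mul_comm m k))⟩

theorem ncard_coord_pow_eq {m : ℕ} (hm0 : 0 < m) (hm : m ∣ Fintype.card F + 1) (R : OnePoint F) :
    {R' | T.coord R' ^ m = T.coord R ^ m}.ncard = m := by
  classical
  obtain ⟨ζ, hζ⟩ := T.exists_isPrimitiveRoot hm
  have hR : T.coord R ≠ 0 := fun h => by simpa [h] using T.coord_pow R
  have himage : T.coord '' {R' | T.coord R' ^ m = T.coord R ^ m} =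
      ((nthRoots m (T.coord R ^ m)).toFinset : Set K) := by
    ext y
    simp only [Set.mem_image, Set.mem_ofPred_eq, Finset.mem_coe, Multiset.mem_toFinset,
      mem_nthRoots hm0]
    constructor
    · rintro ⟨R', h, rfl⟩
      exact h
    · intro h
      obtain ⟨k, hk⟩ := hm
      obtain ⟨R', rfl⟩ := T.exists_coord_eq (y := y) (by
        rw [hk, pow_mul, h, ← pow_mul, ← hk, T.coord_pow])
      exact ⟨R', h, rfl⟩
  rw [← Set.ncard_image_of_injective _ T.coord_injective, himage, Set.ncard_coe_finset,
    Multiset.toFinset_card_of_nodup (hζ.nthRoots_nodup (pow_ne_zero m hR)), hζ.card_nthRoots,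
    if_pos ⟨_, rfl⟩]

end PrimitivePair

/-! ### The generators as rational functions -/

/-- The inclusion of `F(x)` into `K(x)`. -/
noncomputable def incl (F K : Type*) [Field F] [Field K] [Algebra F K] : RatFunc F →+* RatFunc K :=
  RatFunc.mapRingHom (mapRingHom (algebraMap F K))
    (nonZeroDivisors_le_comap_nonZeroDivisors_of_injective _
      (map_injective _ (algebraMap F K).injective))

theorem incl_algebraMap {F K : Type*} [Field F] [Field K] [Algebra F K] (f : F[X]) :
    incl F K (algebraMap F[X] (RatFunc F) f) =
    algebraMap K[X] (RatFunc K) (f.map (algebraMap F K)) := by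
  have h := RatFunc.map_apply_div (mapRingHom (algebraMap F K))
    (nonZeroDivisors_le_comap_nonZeroDivisors_of_injective _
      (map_injective _ (algebraMap F K).injective)) f 1
  rw [map_one, map_one, map_one, div_one, div_one] at h
  exact h

theorem incl_C {F K : Type*} [Field F] [Field K] [Algebra F K] (a : F) :
    incl F K (RatFunc.C a) = RatFunc.C (algebraMap F K a) := by
  rw [← RatFunc.algebraMap_C, incl_algebraMap, map_C, RatFunc.algebraMap_C]

namespace PrimitivePair

variable {F K : Type*} [Field F] [Fintype F] [Field K] [Algebra F K] (T : PrimitivePair F K)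

theorem cast_ne_zero {F : Type*} [Field F] [Fintype F] {m : ℕ} (hm : m ∣ Fintype.card F + 1) :
    (m : F) ≠ 0 := by
  intro h
  obtain ⟨k, hk⟩ := hm
  have h1 : ((Fintype.card F + 1 : ℕ) : F) = 0 := by rw [hk, Nat.cast_mul, h, zero_mul]
  rw [Nat.cast_add, FiniteField.cast_card_eq_zero, zero_add, Nat.cast_one] at h1
  exact one_ne_zero h1

theorem pow_eval (m : ℕ) (x : F) :
    (algebraMap F K x - T.θ) ^ m =
        algebraMap F K ((T.H m).eval x) - T.θ * algebraMap F K ((T.E m).eval x) ∧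
      (algebraMap F K x - T.θ') ^ m =
        algebraMap F K ((T.H m).eval x) - T.θ' * algebraMap F K ((T.E m).eval x) := by
  have key : ∀ η : K, η ^ 2 = algebraMap F K T.s * η - algebraMap F K T.c →
      (algebraMap F K x - η) ^ m =
        algebraMap F K ((T.H m).eval x) - η * algebraMap F K ((T.E m).eval x) := by
    intro η hη
    simpa [H, E] using pow_sub_eq T.s T.c ((algebraMap F K).comp (evalRingHom x)) (θ := η)
      (by simpa using hη) m
  exact ⟨key _ (by rw [← T.θ_add, ← T.θ_mul]; ring), key _ (by rw [← T.θ_add, ← T.θ_mul]; ring)⟩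

theorem eval_E_eq_zero_iff (m : ℕ) (x : F) :
    (T.E m).eval x = 0 ↔ T.coord (x : OnePoint F) ^ m = 1 := by
  obtain ⟨h1, h2⟩ := T.pow_eval m x
  rw [coord_coe, div_pow, div_eq_one_iff_eq (pow_ne_zero m (T.sub_θ'_ne_zero x)), h1, h2]
  constructor
  · intro h
    simp [h]
  · intro h
    have h3 : (T.θ - T.θ') * algebraMap F K ((T.E m).eval x) = 0 := by linear_combination -h
    simpa using (mul_eq_zero.1 h3).resolve_left (sub_ne_zero.2 T.θ_ne)

/-- The function `H_m / E_m` is the power map in the coordinate. -/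
theorem coord_div {m : ℕ} {x : F} (h : (T.E m).eval x ≠ 0) :
    T.coord (((T.H m).eval x / (T.E m).eval x : F) : OnePoint F) =
      T.coord (x : OnePoint F) ^ m := by
  obtain ⟨h1, h2⟩ := T.pow_eval m x
  have h0 : algebraMap F K ((T.E m).eval x) ≠ 0 := by simpa using h
  rw [coord_coe, coord_coe, div_pow, h1, h2, map_div₀, ← mul_div_mul_right _ _ h0, sub_mul,
    sub_mul, div_mul_cancel₀ _ h0]

theorem isCoprime_H_E (m : ℕ) : IsCoprime (T.H m) (T.E m) :=
  isCoprime_powH_powE T.θ_add T.θ_mul T.θ_ne m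

/-- The monic denominator `E_m / m`. -/
noncomputable def monicE (m : ℕ) : F[X] := C (m : F)⁻¹ * T.E m

theorem monic_monicE {m : ℕ} (hm : (m : F) ≠ 0) : (T.monicE m).Monic := by
  rw [Monic, monicE, leadingCoeff_mul, leadingCoeff_C, E, leadingCoeff_powE _ _ hm,
    inv_mul_cancel₀ hm]

theorem natDegree_monicE {m : ℕ} (hm : (m : F) ≠ 0) : (T.monicE m).natDegree = m - 1 := by
  rw [monicE, natDegree_C_mul (inv_ne_zero hm), E, natDegree_powE _ _ hm]

theorem C_mul_monicE {m : ℕ} (hm : (m : F) ≠ 0) : C (m : F) * T.monicE m = T.E m := by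
  rw [monicE, ← mul_assoc, ← C_mul, mul_inv_cancel₀ hm, C_1, one_mul]

/-- For `m ∣ q + 1` the denominator `E_m` is a product of distinct linear factors over `F`. -/
theorem exists_E_eq_prod {m : ℕ} (hm0 : 0 < m) (hm : m ∣ Fintype.card F + 1) :
    ∃ μ : Fin (m - 1) → F, Function.Injective μ ∧ T.E m = C (m : F) * ∏ j, (X - C (μ j)) := by
  classical
  have hmF := cast_ne_zero hm
  have hcard : (Finset.univ.filter fun x => (T.E m).eval x = 0).card = m - 1 := by
    have h1 := T.ncard_coord_pow_eq hm0 hm OnePoint.infty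
    have h2 : {R' | T.coord R' ^ m = T.coord OnePoint.infty ^ m} =
        insert OnePoint.infty ((fun x : F => (x : OnePoint F)) ''
          (Finset.univ.filter fun x => (T.E m).eval x = 0 : Finset F)) := by
      ext R
      induction R using OnePoint.rec with
      | infty => simp
      | coe x => simp [coord_infty, eval_E_eq_zero_iff]
    rw [h2, Set.ncard_insert_of_notMem (by simp) (Set.toFinite _),
      Set.ncard_image_of_injective _ OnePoint.coe_injective, Set.ncard_coe_finset] at h1
    omega
  let e := Finset.equivFinOfCardEq hcard
  have hinj : Function.Injective fun j => (e.symm j : F) :=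
    Subtype.val_injective.comp e.symm.injective
  refine ⟨fun j => e.symm j, hinj, ?_⟩
  have hlead : (T.E m).leadingCoeff = m := leadingCoeff_powE _ _ hmF
  have hdeg : (T.E m).natDegree = m - 1 := natDegree_powE _ _ hmF
  have hE0 : T.E m ≠ 0 := powE_ne_zero _ _ hmF
  have hmon : (∏ j, (X - C (e.symm j : F))).Monic :=
    monic_prod_of_monic _ _ fun j _ => monic_X_sub_C _
  have hdeg' : (C (m : F) * ∏ j, (X - C (e.symm j : F))).natDegree = m - 1 := by
    rw [natDegree_C_mul hmF, natDegree_prod_of_monic _ _ fun j _ => monic_X_sub_C _]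
    simp
  refine eq_of_degree_sub_lt_of_eval_finset_eq
    (Finset.univ.filter fun x => (T.E m).eval x = 0) ?_ fun x hx => ?_
  · refine (degree_sub_lt_left ?_ hE0 ?_).trans_eq ?_
    · rw [degree_eq_natDegree hE0, degree_eq_natDegree (mul_ne_zero (C_ne_zero.2 hmF) hmon.ne_zero),
        hdeg, hdeg']
    · rw [hlead, leadingCoeff_mul, leadingCoeff_C, hmon.leadingCoeff, mul_one]
    · rw [hcard, degree_eq_natDegree hE0, hdeg]
  · rw [(Finset.mem_filter.1 hx).2, eval_mul, eval_prod,
      Finset.prod_eq_zero (Finset.mem_univ (e ⟨x, hx⟩)) (by simp), mul_zero]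

/-- The function `g_m = H_m / E_m`. -/
noncomputable def gen (m : ℕ) : RatFunc F :=
  algebraMap F[X] (RatFunc F) (T.H m) / algebraMap F[X] (RatFunc F) (T.E m)

theorem num_denom_C_mul_gen {m : ℕ} (hm : (m : F) ≠ 0) :
    (RatFunc.C (m : F) * T.gen m).num = T.H m ∧
      (RatFunc.C (m : F) * T.gen m).denom = T.monicE m := by
  have hu : IsUnit (C (m : F)⁻¹) := isUnit_C.2 (inv_ne_zero hm).isUnit
  have h : RatFunc.C (m : F) * T.gen m = algebraMap F[X] (RatFunc F) (T.H m) /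
      algebraMap F[X] (RatFunc F) (T.monicE m) := by
    rw [gen, monicE, map_mul, RatFunc.algebraMap_C, map_inv₀, ← div_div, div_inv_eq_mul]
    ring
  rw [h]
  refine num_denom_of_isCoprime ?_ (T.monic_monicE hm)
  exact (isCoprime_mul_unit_left_right hu _ _).2 (T.isCoprime_H_E m)

/-- The value of the generator of index `m` at a point `R` is `m` times the point whose coordinate is
the `m`-th power of that of `R`. -/
theorem placeValue_gen {m : ℕ} (hm : (m : F) ≠ 0) (R : OnePoint F) :
    ∃ V : OnePoint F, T.coord V = T.coord R ^ m ∧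
      placeValue (RatFunc.C (m : F) * T.gen m) R = OnePoint.map (fun x : F => (m : F) * x) V := by
  obtain ⟨h1, h2⟩ := T.num_denom_C_mul_gen hm
  have hm0 : 0 < m := Nat.pos_of_ne_zero (by rintro rfl; simp at hm)
  induction R using OnePoint.rec with
  | infty =>
    refine ⟨OnePoint.infty, by rw [coord_infty, one_pow], ?_⟩
    have : (RatFunc.C (m : F) * T.gen m).denom.natDegree <
        (RatFunc.C (m : F) * T.gen m).num.natDegree := by
      rw [h1, h2, T.natDegree_monicE hm, H, natDegree_powH]
      omega
    exact if_pos this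
  | coe x =>
    by_cases hE : (T.E m).eval x = 0
    · refine ⟨OnePoint.infty, by rw [coord_infty, (T.eval_E_eq_zero_iff m x).1 hE], if_pos ?_⟩
      rw [h2, monicE, eval_mul, hE, mul_zero]
    · refine ⟨_, T.coord_div hE, ?_⟩
      have : (RatFunc.C (m : F) * T.gen m).denom.eval x ≠ 0 := by
        rw [h2, monicE, eval_mul, eval_C]
        exact mul_ne_zero (inv_ne_zero hm) hE
      refine (if_neg this).trans ?_
      rw [h1, h2, OnePoint.map_some, monicE, eval_mul, eval_C]
      congr 1
      field_simp

/-- The fibres of the generator of index `m` on the projective line over `F` are the fibres of the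
`m`-th power of the coordinate. -/
theorem placeValue_gen_eq_iff {m : ℕ} (hm : (m : F) ≠ 0) (R R' : OnePoint F) :
    placeValue (RatFunc.C (m : F) * T.gen m) R = placeValue (RatFunc.C (m : F) * T.gen m) R' ↔
      T.coord R ^ m = T.coord R' ^ m := by
  obtain ⟨V, h1, h2⟩ := T.placeValue_gen hm R
  obtain ⟨V', h1', h2'⟩ := T.placeValue_gen hm R'
  rw [h2, h2', ← h1, ← h1', T.coord_injective.eq_iff]
  exact (Option.map_injective (mul_right_injective₀ hm)).eq_iff

theorem algebraMap_E_ne_zero {m : ℕ} (hm : (m : F) ≠ 0) :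
    algebraMap F[X] (RatFunc F) (T.E m) ≠ 0 :=
  RatFunc.algebraMap_ne_zero (powE_ne_zero _ _ hm)

/-- The trace of `x` over the subgroup of order `m` in closed form. Both sides are compared in
`K(x)`, where `σ` is a multiplication in the coordinate `y`. -/
theorem traceGen_eq {m : ℕ} (hm0 : 0 < m) (hm : m ∣ Fintype.card F + 1) :
    traceGen T.a T.b m = RatFunc.C (m : F) * T.gen m := by
  have hmF := cast_ne_zero hm
  apply (incl F K).injective
  let ψ : F[X] →+* RatFunc K := (incl F K).comp (algebraMap F[X] (RatFunc F))
  let t : RatFunc K := incl F K RatFunc.X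
  have hψX : ψ X = t := by simp [ψ, t]
  have hψC : ∀ a, ψ (C a) = RatFunc.C (algebraMap F K a) := fun a => by
    simp only [ψ, RingHom.comp_apply, RatFunc.algebraMap_C, incl_C]
  have hs : RatFunc.C T.θ + RatFunc.C T.θ' = ψ (C T.s) := by rw [hψC, ← T.θ_add, map_add]
  have hc : RatFunc.C T.θ * RatFunc.C T.θ' = ψ (C T.c) := by rw [hψC, ← T.θ_mul, map_mul]
  have hne : RatFunc.C T.θ - RatFunc.C T.θ' ≠ 0 :=
    sub_ne_zero.2 fun h => T.θ_ne (RatFunc.C.injective h)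
  have hinvθ : (RatFunc.C T.ρ)⁻¹ = RatFunc.C T.θ := by rw [θ, map_inv₀]
  have hinvθ' : (RatFunc.C T.ρ')⁻¹ = RatFunc.C T.θ' := by rw [θ', map_inv₀]
  have ht' : t - RatFunc.C T.θ' ≠ 0 := by
    have : t = RatFunc.X := by
      simp only [t]
      rw [← RatFunc.algebraMap_X, incl_algebraMap, map_X, RatFunc.algebraMap_X]
    rw [this, ← RatFunc.algebraMap_X, ← RatFunc.algebraMap_C, ← map_sub]
    exact RatFunc.algebraMap_ne_zero (X_sub_C_ne_zero _)
  let y : RatFunc K := (t - RatFunc.C T.θ) / (t - RatFunc.C T.θ')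
  have hE : (RatFunc.C T.θ - RatFunc.C T.θ') * ψ (T.E m) =
      (t - RatFunc.C T.θ') ^ m * (1 - y ^ m) := by
    rw [E, sub_mul_powE ψ hs hc, hψX, div_pow, mul_sub, mul_div_cancel₀ _ (pow_ne_zero m ht'),
      mul_one]
  have hH : (RatFunc.C T.θ - RatFunc.C T.θ') * ψ (T.H m) =
      (t - RatFunc.C T.θ') ^ m * (RatFunc.C T.θ - RatFunc.C T.θ' * y ^ m) := by
    rw [H, sub_mul_powH ψ hs hc, hψX, div_pow, mul_sub, mul_left_comm _ (RatFunc.C T.θ'),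
      mul_div_cancel₀ _ (pow_ne_zero m ht')]
    ring
  have hE0 : ψ (T.E m) ≠ 0 := by
    simpa [ψ] using T.algebraMap_E_ne_zero hmF
  have hy : y ^ m ≠ 1 := fun h => by
    rw [h, sub_self, mul_zero] at hE
    exact mul_ne_zero hne hE0 hE
  have hgen : incl F K (T.gen m) =
      (RatFunc.C T.θ - RatFunc.C T.θ' * y ^ m) / (1 - y ^ m) := by
    rw [show incl F K (T.gen m) = ψ (T.H m) / ψ (T.E m) from map_div₀ _ _ _,
      div_eq_div_iff hE0 (sub_ne_zero.2 hy.symm)]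
    refine mul_left_cancel₀ hne ?_
    linear_combination (1 - y ^ m) * hH - (RatFunc.C T.θ - RatFunc.C T.θ' * y ^ m) * hE
  obtain ⟨d, hd⟩ := hm
  have hζ : IsPrimitiveRoot (RatFunc.C ((T.ρ' / T.ρ) ^ d)) m :=
    (T.isPrimitiveRoot_div.pow (Nat.succ_pos _) (hd.trans (mul_comm m d))).map_of_injective
      (f := (RatFunc.C : K →+* RatFunc K)) (RingHom.injective (RatFunc.C : K →+* RatFunc K))
  rw [map_mul, hgen, incl_C, map_natCast, map_natCast, ← sum_mobius_coord hm0 hζ hy, traceGen,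
    map_sum]
  refine Finset.sum_congr rfl fun k _ => ?_
  rw [hd, Nat.mul_div_cancel_left _ hm0]
  rw [map_mobius_sigma_pow (incl F K) (ρ := RatFunc.C T.ρ) (ρ' := RatFunc.C T.ρ')
    (by rw [incl_C, ← map_add, T.add_eq, map_neg]) (by rw [incl_C, ← map_mul, T.mul_eq])
    (by simpa using T.ρ_ne_zero) (by simpa using T.ρ'_ne_zero)
    (by rw [hinvθ, hinvθ']; exact sub_ne_zero.1 hne) (by rw [hinvθ']; exact ht'), hinvθ, hinvθ',
    ← map_div₀, ← map_pow, ← map_pow, ← pow_mul, mul_comm d k]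

end PrimitivePair

/-! ### Products of polynomials in powers of the variable -/

theorem coeff_mul_expand {K : Type*} [Field K] {k : ℕ} {R : K[X]} (hR : R.natDegree < k) (G : K[X])
    (l s : ℕ) (hs : s < k) :
    (R * expand K k G).coeff (l * k + s) = R.coeff s * G.coeff l := by
  have hk : 0 < k := by omega
  rw [coeff_mul, Finset.sum_eq_single (s, l * k)]
  · simp [coeff_expand hk, hk]
  · rintro ⟨i, j⟩ hij hne
    rw [Finset.HasAntidiagonal.mem_antidiagonal] at hij
    dsimp only at hij ⊢
    by_cases hi : i < k
    · rw [coeff_expand hk, if_neg, mul_zero]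
      rintro ⟨u, rfl⟩
      apply hne
      have h1 : (i + k * u) % k = (l * k + s) % k := by rw [hij]
      rw [Nat.add_mul_mod_self_left, Nat.mod_eq_of_lt hi, mul_comm l, Nat.mul_add_mod,
        Nat.mod_eq_of_lt hs] at h1
      subst h1
      simp only [Prod.mk.injEq, true_and]
      omega
    · rw [coeff_eq_zero_of_natDegree_lt (by omega), zero_mul]
  · intro h
    exact absurd (Finset.HasAntidiagonal.mem_antidiagonal.2 (add_comm _ _)) h

/-- Linearly independent polynomials of degree less than `k` are linearly independent over the ring
of polynomials in `x ^ k`. -/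
theorem eq_zero_of_sum_mul_expand {K ι : Type*} [Field K] [Fintype ι] {k : ℕ} {R : ι → K[X]}
    (hR : ∀ x, (R x).natDegree < k) (hLI : LinearIndependent K R) {G : ι → K[X]}
    (h : ∑ x, R x * expand K k (G x) = 0) (x : ι) : G x = 0 := by
  ext l
  refine Fintype.linearIndependent_iff.1 hLI (fun x => (G x).coeff l) ?_ x
  ext s
  by_cases hs : s < k
  · have := congrArg (fun f => coeff f (l * k + s)) h
    simp only [finsetSum_coeff, coeff_mul_expand (hR _) _ l s hs, coeff_zero] at this
    simpa [finsetSum_coeff, mul_comm] using this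
  · simp only [finsetSum_coeff, coeff_smul, coeff_zero]
    exact Finset.sum_eq_zero fun y _ => by
      rw [coeff_eq_zero_of_natDegree_lt (p := R y) (by have := hR y; omega), smul_zero]

theorem partialProd_cons {r : ℕ} (p : Fin (r + 1) → ℕ) (i : ℕ) :
    partialProd p (i + 1) = p 0 * partialProd (fun j => p j.succ) i := by
  unfold partialProd
  rw [Finset.prod_filter, Finset.prod_filter, Fin.prod_univ_succ]
  simp

/-- The products of polynomials `R_i(x ^ (p_1 ⋯ p_{i-1}))`, each `R_i` from a linearly
independent family of polynomials of degree less than `p_i`, are linearly independent. -/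
theorem linearIndependent_prod_comp {K : Type*} [Field K] {r : ℕ} (p : Fin r → ℕ)
    (R : (i : Fin r) → Fin (p i) → K[X]) (hR : ∀ i e, (R i e).natDegree < p i)
    (hLI : ∀ i, LinearIndependent K (R i)) :
    LinearIndependent K
      (fun e : (i : Fin r) → Fin (p i) => ∏ i, (R i (e i)).comp (X ^ partialProd p i)) := by
  induction r with
  | zero =>
    rw [Fintype.linearIndependent_iff]
    intro g hg e
    rw [Fintype.sum_eq_single e fun x hx => absurd (Subsingleton.elim x e) hx] at hg
    simpa using hg
  | succ r ih =>
    rw [Fintype.linearIndependent_iff]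
    intro g hg
    have hterm : ∀ (x : Fin (p 0)) (e : (i : Fin r) → Fin (p i.succ)),
        ∏ i, (R i ((Fin.cons x e : (i : Fin (r + 1)) → Fin (p i)) i)).comp (X ^ partialProd p i) =
          R 0 x * expand K (p 0)
            (∏ i, (R i.succ (e i)).comp (X ^ partialProd (fun j => p j.succ) i)) := by
      intro x e
      rw [Fin.prod_univ_succ, map_prod]
      congr 1
      · simp [partialProd_zero]
      · refine Finset.prod_congr rfl fun i _ => ?_
        rw [Fin.cons_succ, Fin.val_succ, partialProd_cons, expand_eq_comp_X_pow, comp_assoc,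
          X_pow_comp, ← pow_mul]
    rw [← (Fin.consEquiv fun i => Fin (p i)).sum_comp, Fintype.sum_prod_type] at hg
    have hg' : ∑ x, R 0 x * expand K (p 0)
        (∑ e : (i : Fin r) → Fin (p i.succ), g (Fin.cons x e) •
          ∏ i, (R i.succ (e i)).comp (X ^ partialProd (fun j => p j.succ) i)) = 0 := by
      rw [← hg]
      refine Finset.sum_congr rfl fun x _ => ?_
      rw [map_sum, Finset.mul_sum]
      refine Finset.sum_congr rfl fun e _ => ?_
      rw [map_smul, mul_smul_comm, ← hterm]
      rfl
    have h0 := eq_zero_of_sum_mul_expand (hR 0) (hLI 0) hg'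
    intro e
    have := Fintype.linearIndependent_iff.1
      (ih (fun j => p j.succ) (fun i => R i.succ) (fun i => hR i.succ) fun i => hLI i.succ) _
      (h0 (e 0)) (Fin.tail e)
    rwa [Fin.cons_self_tail] at this

/-- Polynomials that vanish at `z` to the order of their index are linearly independent. -/
theorem linearIndependent_of_order {K : Type*} [Field K] {k : ℕ} (S : Fin k → K[X]) (A : K[X])
    (hA : A ≠ 0) {z : K} (hz : A.eval z = 0) (hS : ∀ e, (S e).eval z ≠ 0) :
    LinearIndependent K (fun e : Fin k => A ^ (e : ℕ) * S e) := by
  rw [Fintype.linearIndependent_iff]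
  intro g hg e
  induction e using WellFoundedLT.induction with
  | ind e ih =>
    have h1 : A ^ (e : ℕ) * ∑ x, (if x < e then 0 else g x • (A ^ ((x : ℕ) - e) * S x)) = 0 := by
      refine Eq.trans ?_ hg
      rw [Finset.mul_sum]
      refine Finset.sum_congr rfl fun x _ => ?_
      split_ifs with hx
      · simp [ih x hx]
      · rw [mul_smul_comm, ← mul_assoc, ← pow_add, Nat.add_sub_cancel' (not_lt.1 hx)]
    have h2 := congrArg (eval z) ((mul_eq_zero.1 h1).resolve_left (pow_ne_zero _ hA))
    rw [eval_finsetSum, Finset.sum_eq_single e, if_neg (lt_irrefl e), eval_zero] at h2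
    · simpa [hS e] using h2
    · intro x _ hx
      split_ifs with hlt
      · simp
      · have : (x : ℕ) - e ≠ 0 := by
          have := lt_of_le_of_ne (not_lt.1 hlt) hx.symm
          have : (e : ℕ) < x := this
          omega
        simp [hz, this]
    · simp

theorem prod_telescope {M : Type*} [CommMonoid M] {r : ℕ} (f : ℕ → M) (g : Fin r → M) (h0 : f 0 = 1)
    (h : ∀ i : Fin r, f (i + 1) = f i * g i) : f r = ∏ i, g i := by
  induction r with
  | zero => simpa using h0
  | succ r ih =>
    rw [Fin.prod_univ_castSucc, ← ih (fun i => g i.castSucc) fun i => h i.castSucc]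
    exact h (Fin.last r)

theorem sum_partialProd_mul {r : ℕ} (p : Fin r → ℕ) (hp : ∀ i, 0 < p i) :
    ∑ i : Fin r, partialProd p i * (p i - 1) + 1 = ∏ i, p i := by
  rw [← partialProd_last]
  have h := prod_telescope (M := Multiplicative ℤ)
    (fun i => Multiplicative.ofAdd ((partialProd p i : ℤ) - 1))
    (fun i => Multiplicative.ofAdd ((partialProd p i : ℤ) * (p i - 1 : ℕ)))
    (by simp [partialProd_zero]) (fun i => by
      rw [← ofAdd_add, partialProd_succ]
      congr 1
      push_cast [Nat.cast_sub (hp i)]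
      ring)
  rw [← ofAdd_sum] at h
  have h' := Multiplicative.ofAdd.injective h
  have : ((∑ i : Fin r, partialProd p i * (p i - 1) + 1 : ℕ) : ℤ) = partialProd p r := by
    push_cast
    linarith
  exact_mod_cast this

namespace PrimitivePair

/-! ### One level of the tower -/

variable {F K : Type*} [Field F] [Fintype F] [Field K] [Algebra F K] (T : PrimitivePair F K)

theorem incl_comp_C {F K : Type*} [Field F] [Field K] [Algebra F K] (a : F) :
    (incl F K).comp (algebraMap F[X] (RatFunc F)) (C a) = RatFunc.C (algebraMap F K a) := by
  rw [RingHom.comp_apply, RatFunc.algebraMap_C, incl_C]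

theorem gen_mul {m : ℕ} (hm : (m : F) ≠ 0) (k : ℕ) :
    algebraMap F[X] (RatFunc F) (T.E (m * k)) =
        aeval (T.gen m) (T.E k) * algebraMap F[X] (RatFunc F) (T.E m) ^ k ∧
      algebraMap F[X] (RatFunc F) (T.H (m * k)) =
        aeval (T.gen m) (T.H k) * algebraMap F[X] (RatFunc F) (T.E m) ^ k := by
  have h := powE_mul (s := T.s) (c := T.c)
    ((incl F K).comp (algebraMap F[X] (RatFunc F)))
    ((incl F K).comp (aeval (R := F) (T.gen m)).toRingHom)
    (fun a => by
      rw [incl_comp_C]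
      rw [RingHom.comp_apply, AlgHom.toRingHom_eq_coe, RingHom.coe_coe, aeval_C,
        RatFunc.algebraMap_eq_C, incl_C])
    (θ := RatFunc.C T.θ) (θ' := RatFunc.C T.θ')
    (by rw [incl_comp_C, ← T.θ_add, map_add]) (by rw [incl_comp_C, ← T.θ_mul, map_mul])
    (fun h => T.θ_ne (RatFunc.C.injective h)) (m := m) (by
      simp only [RingHom.comp_apply, ← map_mul]
      congr 1
      have := T.algebraMap_E_ne_zero hm
      simp only [AlgHom.toRingHom_eq_coe, RingHom.coe_coe, aeval_X, gen]
      exact div_mul_cancel₀ _ this) k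
  constructor <;> apply (incl F K).injective
  · rw [map_mul, map_pow]
    exact h.1
  · rw [map_mul, map_pow]
    exact h.2

/-- The polynomial `H_m - μ E_m`: the numerator of `g_m - μ`. -/
noncomputable def shiftH (m : ℕ) (μ : F) : F[X] := T.H m - C μ * T.E m

theorem gen_sub_C {m : ℕ} (hm : (m : F) ≠ 0) (μ : F) :
    T.gen m - RatFunc.C μ =
      algebraMap F[X] (RatFunc F) (T.shiftH m μ) / algebraMap F[X] (RatFunc F) (T.E m) := by
  rw [eq_div_iff (T.algebraMap_E_ne_zero hm), sub_mul, gen,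
    div_mul_cancel₀ _ (T.algebraMap_E_ne_zero hm), shiftH, map_sub, map_mul, RatFunc.algebraMap_C]

theorem C_mul_gen_sub_C {m : ℕ} (hm : (m : F) ≠ 0) (μ : F) :
    RatFunc.C (m : F) * T.gen m - RatFunc.C (m * μ) =
      algebraMap F[X] (RatFunc F) (T.shiftH m μ) / algebraMap F[X] (RatFunc F) (T.monicE m) := by
  have hm' : (RatFunc.C (m : F)) ≠ 0 :=
    (map_ne_zero_iff _ (RingHom.injective (RatFunc.C : F →+* RatFunc F))).2 hm
  rw [map_mul, ← mul_sub, T.gen_sub_C hm, ← T.C_mul_monicE hm, map_mul, RatFunc.algebraMap_C,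
    ← mul_div_assoc,
    mul_div_mul_left _ _ hm']

theorem E_mul {m k : ℕ} (hm : (m : F) ≠ 0) (hk : 0 < k) {μ : Fin (k - 1) → F}
    (hμ : T.E k = C (k : F) * ∏ j, (X - C (μ j))) :
    T.E (m * k) = T.E m * (C (k : F) * ∏ j, T.shiftH m (μ j)) := by
  apply RatFunc.algebraMap_injective F
  have hE := T.algebraMap_E_ne_zero hm
  have hpow : algebraMap F[X] (RatFunc F) (T.E m) ^ k =
      algebraMap F[X] (RatFunc F) (T.E m) ^ (k - 1) * algebraMap F[X] (RatFunc F) (T.E m) := by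
    rw [← pow_succ, Nat.sub_add_cancel hk]
  rw [(T.gen_mul hm k).1, hμ, hpow]
  simp only [map_mul, map_prod, map_sub, aeval_X, aeval_C, RatFunc.algebraMap_eq_C,
    T.gen_sub_C hm, Finset.prod_div_distrib, Finset.prod_const, Finset.card_univ, Fintype.card_fin,
    RatFunc.algebraMap_C]
  field_simp

theorem monicE_mul {m k : ℕ} (hm : (m : F) ≠ 0) (hk : (k : F) ≠ 0) {μ : Fin (k - 1) → F}
    (hμ : T.E k = C (k : F) * ∏ j, (X - C (μ j))) :
    T.monicE (m * k) = T.monicE m * ∏ j, T.shiftH m (μ j) := by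
  have hk0 : 0 < k := Nat.pos_of_ne_zero (by rintro rfl; simp at hk)
  have hmk : ((m * k : ℕ) : F) ≠ 0 := by
    rw [Nat.cast_mul]
    exact mul_ne_zero hm hk
  refine mul_left_cancel₀ (C_ne_zero.2 hmk) ?_
  rw [T.C_mul_monicE hmk, T.E_mul hm hk0 hμ, ← T.C_mul_monicE hm, Nat.cast_mul, C_mul]
  ring

/-- The generator of index `m k` as a function of the generator of index `m`, in lowest terms. -/
theorem exists_gen_mul_eq {m k : ℕ} (hm : (m : F) ≠ 0) (hk : (k : F) ≠ 0) {μ : Fin (k - 1) → F}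
    (hμ : T.E k = C (k : F) * ∏ j, (X - C (μ j))) :
    ∃ u : F[X], u.natDegree = k ∧ (∀ j, u.eval (m * μ j) ≠ 0) ∧
      RatFunc.C ((m * k : ℕ) : F) * T.gen (m * k) =
        aeval (RatFunc.C (m : F) * T.gen m) u /
          ∏ j, (RatFunc.C (m : F) * T.gen m - RatFunc.C (m * μ j)) := by
  have hk0 : 0 < k := Nat.pos_of_ne_zero (by rintro rfl; simp at hk)
  have hX : (C (m : F)⁻¹ * X : F[X]).natDegree = 1 := natDegree_C_mul_X _ (inv_ne_zero hm)
  refine ⟨C ((m : F) ^ k) * (T.H k).comp (C (m : F)⁻¹ * X), ?_, fun j => ?_, ?_⟩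
  · rw [natDegree_C_mul (pow_ne_zero k hm), natDegree_comp, hX, mul_one, H, natDegree_powH]
  · rw [eval_mul, eval_C, eval_comp, eval_mul, eval_C, eval_X, inv_mul_cancel_left₀ hm]
    refine mul_ne_zero (pow_ne_zero k hm) fun h0 => ?_
    obtain ⟨u, v, huv⟩ := T.isCoprime_H_E k
    have h1 := congrArg (eval (μ j)) huv
    rw [eval_add, eval_mul, eval_mul, h0, hμ, eval_mul, eval_prod,
      Finset.prod_eq_zero (Finset.mem_univ j) (by simp)] at h1
    simp at h1
  · have hCm : (RatFunc.C (m : F)) ≠ 0 :=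
      (map_ne_zero_iff _ (RingHom.injective (RatFunc.C : F →+* RatFunc F))).2 hm
    have hCk : (RatFunc.C (k : F)) ≠ 0 :=
      (map_ne_zero_iff _ (RingHom.injective (RatFunc.C : F →+* RatFunc F))).2 hk
    have hE := T.algebraMap_E_ne_zero hm
    have hu : aeval (RatFunc.C (m : F) * T.gen m)
        (C ((m : F) ^ k) * (T.H k).comp (C (m : F)⁻¹ * X)) =
        RatFunc.C (m : F) ^ k * aeval (T.gen m) (T.H k) := by
      rw [map_mul, aeval_C, aeval_comp, map_mul, aeval_C, aeval_X, RatFunc.algebraMap_eq_C, map_pow,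
        map_inv₀, inv_mul_cancel_left₀ hCm]
    have hprod : ∏ j, (RatFunc.C (m : F) * T.gen m - RatFunc.C (m * μ j)) =
        RatFunc.C (m : F) ^ (k - 1) * ∏ j, (T.gen m - RatFunc.C (μ j)) := by
      simp only [map_mul, ← mul_sub, Finset.prod_mul_distrib, Finset.prod_const, Finset.card_univ,
        Fintype.card_fin]
    have hEk : aeval (T.gen m) (T.E k) =
        RatFunc.C (k : F) * ∏ j, (T.gen m - RatFunc.C (μ j)) := by
      rw [hμ]
      simp only [map_mul, map_prod, map_sub, aeval_X, aeval_C, RatFunc.algebraMap_eq_C]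
    have hpow : RatFunc.C (m : F) ^ k = RatFunc.C (m : F) ^ (k - 1) * RatFunc.C (m : F) := by
      rw [← pow_succ, Nat.sub_add_cancel hk0]
    rw [hu, hprod, gen, (T.gen_mul hm k).1, (T.gen_mul hm k).2, hEk,
      mul_div_mul_right _ _ (pow_ne_zero k hE), hpow, mul_assoc (RatFunc.C (m : F) ^ (k - 1)),
      mul_div_mul_left _ _ (pow_ne_zero _ hCm), Nat.cast_mul, map_mul, mul_assoc, ← mul_div_assoc,
      mul_div_mul_left _ _ hCk, mul_div_assoc]

theorem card_filter_val_lt {k e : ℕ} (he : e < k) :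
    (Finset.univ.filter fun j : Fin (k - 1) => (j : ℕ) < e).card = e ∧
      (Finset.univ.filter fun j : Fin (k - 1) => ¬(j : ℕ) < e).card = k - 1 - e := by
  have h1 : (Finset.univ.filter fun j : Fin (k - 1) => (j : ℕ) < e).card = e := by
    rw [Fin.card_filter_val_lt]
    omega
  have h2 := Finset.card_filter_add_card_filter_not (s := Finset.univ)
    (fun j : Fin (k - 1) => (j : ℕ) < e)
  rw [h1, Finset.card_univ, Fintype.card_fin] at h2
  exact ⟨h1, by omega⟩

/-- The contribution of one level of the tower, with digit `e`, to a basis polynomial. -/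
noncomputable def levelPoly (m : ℕ) {k : ℕ} (μ : Fin (k - 1) → F) (e : ℕ) : F[X] :=
  T.monicE m ^ e *
    ∏ j ∈ Finset.univ.filter (fun j : Fin (k - 1) => ¬(j : ℕ) < e), T.shiftH m (μ j)

theorem natDegree_shiftH_le (m : ℕ) (μ : F) : (T.shiftH m μ).natDegree ≤ m := by
  refine (natDegree_sub_le _ _).trans (max_le (natDegree_powH _ _ m).le ?_)
  exact (natDegree_C_mul_le _ _).trans ((natDegree_powE_le _ _ m).trans (Nat.sub_le _ _))

theorem shiftH_ne_zero {m : ℕ} (hm : 0 < m) (μ : F) : T.shiftH m μ ≠ 0 := by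
  intro h
  have h1 := congrArg natDegree (sub_eq_zero.1 h)
  have h2 : (C μ * T.E m).natDegree ≤ m - 1 :=
    (natDegree_C_mul_le _ _).trans (natDegree_powE_le _ _ m)
  rw [← h1, H, natDegree_powH] at h2
  omega

theorem natDegree_levelPoly_le {m k : ℕ} (hm : (m : F) ≠ 0) (μ : Fin (k - 1) → F) {e : ℕ}
    (he : e < k) : (T.levelPoly m μ e).natDegree ≤ m * (k - 1) := by
  obtain ⟨-, h2⟩ := card_filter_val_lt he
  have h3 : (T.monicE m ^ e).natDegree ≤ e * m := by
    refine natDegree_pow_le.trans (Nat.mul_le_mul_left e ?_)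
    rw [T.natDegree_monicE hm]
    exact Nat.sub_le _ _
  have h4 : (∏ j ∈ Finset.univ.filter (fun j : Fin (k - 1) => ¬(j : ℕ) < e),
      T.shiftH m (μ j)).natDegree ≤ (k - 1 - e) * m := by
    refine (natDegree_prod_le _ _).trans ?_
    rw [← h2, ← smul_eq_mul]
    exact Finset.sum_le_card_nsmul _ _ _ fun j _ => T.natDegree_shiftH_le m (μ j)
  refine natDegree_mul_le.trans ((Nat.add_le_add h3 h4).trans_eq ?_)
  rw [← add_mul, Nat.add_sub_cancel' (by omega), mul_comm]

/-- In `N z_0 ⋯ z_{r-1}` the product of all `H_m - μ_j E_m` is the share of one level in `N`, and the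
inverse is the factor `z` of this level. -/
theorem prod_shiftH_mul_inv {m k : ℕ} (hm : (m : F) ≠ 0) (μ : Fin (k - 1) → F) {e : ℕ}
    (he : e < k) :
    algebraMap F[X] (RatFunc F) (∏ j, T.shiftH m (μ j)) *
      (∏ j ∈ Finset.univ.filter (fun j : Fin (k - 1) => (j : ℕ) < e),
        (RatFunc.C (m : F) * T.gen m - RatFunc.C (m * μ j)))⁻¹ =
      algebraMap F[X] (RatFunc F) (T.levelPoly m μ e) := by
  obtain ⟨h1, -⟩ := card_filter_val_lt he
  have hm0 : 0 < m := Nat.pos_of_ne_zero (by rintro rfl; simp at hm)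
  have hne : ∏ j ∈ Finset.univ.filter (fun j : Fin (k - 1) => (j : ℕ) < e),
      algebraMap F[X] (RatFunc F) (T.shiftH m (μ j)) ≠ 0 :=
    Finset.prod_ne_zero_iff.2 fun j _ => RatFunc.algebraMap_ne_zero (T.shiftH_ne_zero hm0 _)
  rw [Finset.prod_congr rfl fun j _ => T.C_mul_gen_sub_C hm (μ j), Finset.prod_div_distrib,
    Finset.prod_const, h1, inv_div, levelPoly,
    ← Finset.prod_filter_mul_prod_filter_not Finset.univ (fun j : Fin (k - 1) => (j : ℕ) < e),
    map_mul, map_mul, map_pow, map_prod]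
  field_simp

/-! ### The values of the basis functions -/

open Classical in
/-- The part of the value at `x` of the contribution of one level that depends on the digit `e`.
At a pole of the generator `g_m` it vanishes except for the digit `0`. -/
noncomputable def levelFactor (m : ℕ) {k : ℕ} (μ : Fin (k - 1) → F) (e : ℕ) (x : F) : F :=
  if (T.E m).eval x = 0 then (if e = 0 then 1 else 0)
  else (m : F)⁻¹ ^ e * ∏ j ∈ Finset.univ.filter (fun j : Fin (k - 1) => ¬(j : ℕ) < e),
    ((T.H m).eval x / (T.E m).eval x - μ j)

open Classical in
/-- The part of the value at `x` of the contribution of one level that does not depend on the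
digit. -/
noncomputable def levelScale (m k : ℕ) (x : F) : F :=
  if (T.E m).eval x = 0 then (T.H m).eval x ^ (k - 1) else (T.E m).eval x ^ (k - 1)

theorem eval_levelPoly (m : ℕ) {k : ℕ} (μ : Fin (k - 1) → F) {e : ℕ} (he : e < k) (x : F) :
    (T.levelPoly m μ e).eval x = T.levelScale m k x * T.levelFactor m μ e x := by
  obtain ⟨-, h2⟩ := card_filter_val_lt he
  unfold levelPoly levelScale levelFactor
  simp only [monicE, shiftH, eval_mul, eval_pow, eval_C, eval_prod, eval_sub]
  by_cases hE : (T.E m).eval x = 0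
  · by_cases he0 : e = 0
    · subst he0
      simp [hE]
    · simp [hE, he0]
  · rw [if_neg hE, if_neg hE]
    have h3 : ∀ j, (T.H m).eval x - μ j * (T.E m).eval x =
        (T.E m).eval x * ((T.H m).eval x / (T.E m).eval x - μ j) := fun j => by
      field_simp
    simp only [h3, Finset.prod_mul_distrib, Finset.prod_const, h2]
    have h4 : (T.E m).eval x ^ (k - 1) = (T.E m).eval x ^ e * (T.E m).eval x ^ (k - 1 - e) := by
      rw [← pow_add, Nat.add_sub_cancel' (by omega)]
    rw [h4, mul_pow]
    ring

theorem levelFactor_congr (m : ℕ) {k : ℕ} (μ : Fin (k - 1) → F) (e : ℕ) {x y : F}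
    (h : T.coord (x : OnePoint F) ^ m = T.coord (y : OnePoint F) ^ m) :
    T.levelFactor m μ e x = T.levelFactor m μ e y := by
  unfold levelFactor
  have h1 : (T.E m).eval x = 0 ↔ (T.E m).eval y = 0 := by
    rw [eval_E_eq_zero_iff, eval_E_eq_zero_iff, h]
  by_cases hx : (T.E m).eval x = 0
  · rw [if_pos hx, if_pos (h1.1 hx)]
  · have hy := fun hy => hx (h1.2 hy)
    have h2 := T.coord_injective ((T.coord_div hx).trans (h.trans (T.coord_div hy).symm))
    rw [if_neg hx, if_neg hy, OnePoint.coe_injective h2]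

/-! ### Linear independence of the basis functions -/

/-- The contribution of one level, as a polynomial in the `m`-th power of the coordinate. -/
noncomputable def levelCoord (m : ℕ) {k : ℕ} (μ : Fin (k - 1) → F) (e : ℕ) : K[X] :=
  (C ((m : K) * (T.θ - T.θ'))⁻¹ * (1 - X)) ^ e *
    ∏ j ∈ Finset.univ.filter (fun j : Fin (k - 1) => ¬(j : ℕ) < e),
      (X + C ((T.θ - algebraMap F K (μ j)) / (T.θ - T.θ')) * (1 - X))

theorem natDegree_levelCoord_lt (m : ℕ) {k : ℕ} (μ : Fin (k - 1) → F) {e : ℕ} (he : e < k) :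
    (T.levelCoord m μ e).natDegree < k := by
  obtain ⟨-, h2⟩ := card_filter_val_lt he
  have h1X : (1 - X : K[X]).natDegree ≤ 1 := by
    refine (natDegree_sub_le _ _).trans (by simp)
  have h3 : ((C ((m : K) * (T.θ - T.θ'))⁻¹ * (1 - X)) ^ e).natDegree ≤ e * 1 :=
    natDegree_pow_le.trans (Nat.mul_le_mul_left e ((natDegree_C_mul_le _ _).trans h1X))
  have h4 : (∏ j ∈ Finset.univ.filter (fun j : Fin (k - 1) => ¬(j : ℕ) < e),
      (X + C ((T.θ - algebraMap F K (μ j)) / (T.θ - T.θ')) * (1 - X))).natDegree ≤ k - 1 - e := by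
    refine (natDegree_prod_le _ _).trans ?_
    rw [← h2, Finset.card_eq_sum_ones]
    refine Finset.sum_le_sum fun j _ => ?_
    exact (natDegree_add_le _ _).trans
      (max_le natDegree_X_le ((natDegree_C_mul_le _ _).trans h1X))
  have := natDegree_mul_le.trans (Nat.add_le_add h3 h4)
  exact lt_of_le_of_lt this (by omega)

theorem linearIndependent_levelCoord {m : ℕ} (hm : (m : K) ≠ 0) {k : ℕ} (μ : Fin (k - 1) → F) :
    LinearIndependent K (fun e : Fin k => T.levelCoord m μ e) := by
  have hd : (m : K) * (T.θ - T.θ') ≠ 0 := mul_ne_zero hm (sub_ne_zero.2 T.θ_ne)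
  refine linearIndependent_of_order (fun e : Fin k =>
    ∏ j ∈ Finset.univ.filter (fun j : Fin (k - 1) => ¬(j : ℕ) < e),
      (X + C ((T.θ - algebraMap F K (μ j)) / (T.θ - T.θ')) * (1 - X)))
    (C ((m : K) * (T.θ - T.θ'))⁻¹ * (1 - X)) ?_ (z := 1) (by simp) fun e => ?_
  · refine mul_ne_zero (C_ne_zero.2 (inv_ne_zero hd)) ?_
    rw [← neg_sub, neg_ne_zero, ← C_1]
    exact X_sub_C_ne_zero 1
  · rw [eval_prod]
    exact Finset.prod_ne_zero_iff.2 fun j _ => by simp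

theorem one_sub_X_ne_zero (K : Type*) [Field K] : (1 - RatFunc.X : RatFunc K) ≠ 0 := by
  rw [← RatFunc.algebraMap_X, ← map_one (algebraMap K[X] (RatFunc K)), ← map_sub]
  refine RatFunc.algebraMap_ne_zero ?_
  rw [← neg_sub, neg_ne_zero, ← C_1]
  exact X_sub_C_ne_zero 1

/-- The substitution of `(θ - θ' y) / (1 - y)` for `x`, where `y = (x - θ) / (x - θ')` is the
coordinate: a homomorphism from `F[x]` to `K(y)`. -/
noncomputable def subst : F[X] →+* RatFunc K :=
  eval₂RingHom ((RatFunc.C : K →+* RatFunc K).comp (algebraMap F K))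
    ((RatFunc.C T.θ - RatFunc.C T.θ' * RatFunc.X) / (1 - RatFunc.X))

theorem subst_C (a : F) : T.subst (C a) = RatFunc.C (algebraMap F K a) := by
  simp [subst]

/-- The function `x - θ'` in terms of the coordinate. -/
noncomputable def substDen : RatFunc K :=
  (RatFunc.C T.θ - RatFunc.C T.θ') / (1 - RatFunc.X)

theorem C_sub_ne_zero : (RatFunc.C T.θ - RatFunc.C T.θ' : RatFunc K) ≠ 0 :=
  sub_ne_zero.2 fun h => T.θ_ne (RatFunc.C.injective h)

theorem substDen_ne_zero : T.substDen ≠ 0 :=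
  div_ne_zero T.C_sub_ne_zero (one_sub_X_ne_zero K)

theorem subst_X_sub : T.subst X - RatFunc.C T.θ' = T.substDen ∧
    T.subst X - RatFunc.C T.θ = RatFunc.X * T.substDen := by
  have h := one_sub_X_ne_zero K
  simp only [subst, coe_eval₂RingHom, eval₂_X, substDen]
  constructor
  · field_simp
    ring
  · field_simp
    ring

theorem subst_E (m : ℕ) : (RatFunc.C T.θ - RatFunc.C T.θ') * T.subst (T.E m) =
    T.substDen ^ m * (1 - RatFunc.X ^ m) := by
  rw [E, sub_mul_powE T.subst (by rw [subst_C, ← T.θ_add, map_add])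
    (by rw [subst_C, ← T.θ_mul, map_mul]), T.subst_X_sub.1, T.subst_X_sub.2]
  ring

theorem subst_H (m : ℕ) : (RatFunc.C T.θ - RatFunc.C T.θ') * T.subst (T.H m) =
    T.substDen ^ m * (RatFunc.C T.θ - RatFunc.C T.θ' * RatFunc.X ^ m) := by
  rw [H, sub_mul_powH T.subst (by rw [subst_C, ← T.θ_add, map_add])
    (by rw [subst_C, ← T.θ_mul, map_mul]), T.subst_X_sub.1, T.subst_X_sub.2]
  ring

theorem subst_monicE {m : ℕ} (hm : (m : K) ≠ 0) : T.subst (T.monicE m) = T.substDen ^ m *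
    algebraMap K[X] (RatFunc K) ((C ((m : K) * (T.θ - T.θ'))⁻¹ * (1 - X)).comp (X ^ m)) := by
  have hd := T.C_sub_ne_zero
  have hm' : (m : RatFunc K) ≠ 0 := by
    rw [← map_natCast (RatFunc.C : K →+* RatFunc K)]
    exact (map_ne_zero_iff _ (RingHom.injective (RatFunc.C : K →+* RatFunc K))).2 hm
  refine mul_left_cancel₀ hd ?_
  rw [monicE, map_mul, subst_C, mul_left_comm, subst_E]
  simp only [mul_comp, C_comp, sub_comp, one_comp, X_comp, map_mul, map_sub, map_one, map_pow,
    RatFunc.algebraMap_C, RatFunc.algebraMap_X, map_inv₀, map_natCast]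
  field_simp

theorem subst_shiftH (m : ℕ) (μ : F) : T.subst (T.shiftH m μ) = T.substDen ^ m *
    algebraMap K[X] (RatFunc K)
      ((X + C ((T.θ - algebraMap F K μ) / (T.θ - T.θ')) * (1 - X)).comp (X ^ m)) := by
  have hd := T.C_sub_ne_zero
  refine mul_left_cancel₀ hd ?_
  rw [shiftH, map_sub, map_mul, subst_C, mul_sub, mul_left_comm, subst_E, subst_H]
  simp only [add_comp, mul_comp, C_comp, sub_comp, one_comp, X_comp, map_add, map_mul, map_sub,
    map_one, map_pow, RatFunc.algebraMap_C, RatFunc.algebraMap_X, map_div₀]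
  field_simp
  ring

theorem subst_levelPoly {m k : ℕ} (hm : (m : K) ≠ 0) (μ : Fin (k - 1) → F) {e : ℕ} (he : e < k) :
    T.subst (T.levelPoly m μ e) = T.substDen ^ (m * (k - 1)) *
      algebraMap K[X] (RatFunc K) ((T.levelCoord m μ e).comp (X ^ m)) := by
  obtain ⟨-, h2⟩ := card_filter_val_lt he
  have hk : T.substDen ^ (m * (k - 1)) = (T.substDen ^ m) ^ e * (T.substDen ^ m) ^ (k - 1 - e) := by
    rw [← pow_add, ← pow_mul, Nat.add_sub_cancel' (by omega)]
  rw [levelPoly, map_mul, map_pow, map_prod, T.subst_monicE hm,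
    Finset.prod_congr rfl fun j _ => T.subst_shiftH m (μ j), Finset.prod_mul_distrib,
    Finset.prod_const, h2, hk, levelCoord, mul_comp _ (Finset.prod _ _),
    pow_comp, prod_comp, map_mul _ (_ ^ e), map_pow, map_prod]
  ring

/-- The basis polynomial whose index has the digits `e`. -/
noncomputable def basisPoly {r : ℕ} (p : Fin r → ℕ) (μ : (i : Fin r) → Fin (p i - 1) → F)
    (e : (i : Fin r) → Fin (p i)) : F[X] :=
  ∏ i : Fin r, T.levelPoly (partialProd p i) (μ i) (e i)

theorem linearIndependent_basisPoly {r : ℕ} {p : Fin r → ℕ} (μ : (i : Fin r) → Fin (p i - 1) → F)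
    (hm : ∀ i : Fin r, (partialProd p i : K) ≠ 0) : LinearIndependent F (T.basisPoly p μ) := by
  rw [Fintype.linearIndependent_iff]
  intro g hg e
  have hLI := linearIndependent_prod_comp p (fun i (x : Fin (p i)) =>
      T.levelCoord (partialProd p i) (μ i) x)
    (fun i x => T.natDegree_levelCoord_lt _ _ x.2) fun i => T.linearIndependent_levelCoord (hm i) _
  let D : RatFunc K := ∏ i : Fin r, T.substDen ^ (partialProd p i * (p i - 1))
  have hD : D ≠ 0 := Finset.prod_ne_zero_iff.2 fun i _ => pow_ne_zero _ T.substDen_ne_zero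
  have h1 : D * algebraMap K[X] (RatFunc K) (∑ e : (i : Fin r) → Fin (p i), algebraMap F K (g e) •
      ∏ i : Fin r, (T.levelCoord (partialProd p i) (μ i) (e i)).comp (X ^ partialProd p i)) = 0 := by
    rw [← map_zero T.subst, ← hg, map_sum, map_sum, Finset.mul_sum]
    refine Finset.sum_congr rfl fun e _ => ?_
    rw [smul_eq_C_mul, smul_eq_C_mul, map_mul, map_mul, subst_C, RatFunc.algebraMap_C, basisPoly,
      map_prod, map_prod, Finset.prod_congr rfl fun i _ => T.subst_levelPoly (hm i) (μ i) (e i).2,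
      Finset.prod_mul_distrib]
    ring
  have h2 := (mul_eq_zero.1 h1).resolve_left hD
  rw [map_eq_zero_iff _ (RatFunc.algebraMap_injective K)] at h2
  have h3 := Fintype.linearIndependent_iff.1 hLI _ h2 e
  simpa using h3

theorem isBasisDegreeLT_basisPoly {r : ℕ} {p : Fin r → ℕ} (μ : (i : Fin r) → Fin (p i - 1) → F)
    (hp : ∀ i, (p i).Prime) (hm : ∀ i : Fin r, (partialProd p i : F) ≠ 0) :
    IsBasisDegreeLT (∏ i, p i) (T.basisPoly p μ) := by
  have hmK : ∀ i : Fin r, (partialProd p i : K) ≠ 0 := fun i => by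
    rw [← map_natCast (algebraMap F K)]
    exact (map_ne_zero_iff _ (algebraMap F K).injective).2 (hm i)
  have : ∀ i, NeZero (p i) := fun i => ⟨(hp i).ne_zero⟩
  refine isBasisDegreeLT_of_linearIndependent (T.linearIndependent_basisPoly μ hmK) (fun e => ?_)
    (by simp)
  have h : (T.basisPoly p μ e).natDegree < ∏ i, p i := by
    rw [← sum_partialProd_mul p fun i => (hp i).pos, Nat.lt_succ_iff]
    exact (natDegree_prod_le _ _).trans
      (Finset.sum_le_sum fun i _ => T.natDegree_levelPoly_le (hm i) (μ i) (e i).2)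
  exact degree_le_natDegree.trans_lt (by exact_mod_cast h)

/-! ### The cyclic case -/

theorem towerGen_eq {r : ℕ} {p : Fin r → ℕ} (hp : ∀ i, (p i).Prime)
    (hn : ∏ i, p i ∣ Fintype.card F + 1) (i : ℕ) :
    towerGen T.a T.b p i = RatFunc.C (partialProd p i : F) * T.gen (partialProd p i) :=
  T.traceGen_eq (Finset.prod_pos fun j _ => (hp j).pos) ((partialProd_dvd p i).trans hn)

theorem placeValue_gen_infty {m : ℕ} (hm : (m : F) ≠ 0) :
    placeValue (RatFunc.C (m : F) * T.gen m) OnePoint.infty = OnePoint.infty := by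
  obtain ⟨V, h1, h2⟩ := T.placeValue_gen hm OnePoint.infty
  rw [coord_infty, one_pow, ← T.coord_infty] at h1
  rw [h2, T.coord_injective h1]
  rfl

/-- For a proper divisor `n` of `q + 1` the place `Q` is the value at a point whose coordinate is a
generator of the group of `(q + 1)`-th roots of unity. -/
theorem exists_split_place {n : ℕ} (hn : n ∣ Fintype.card F + 1) :
    ∃ R : OnePoint F,
      (placeValue (RatFunc.C (n : F) * T.gen n) R = OnePoint.infty ↔ n = Fintype.card F + 1) := by
  have hnF := cast_ne_zero hn
  by_cases h : n = Fintype.card F + 1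
  · exact ⟨OnePoint.infty, iff_of_true (T.placeValue_gen_infty hnF) h⟩
  · obtain ⟨R, hR⟩ := T.exists_coord_eq T.isPrimitiveRoot_div.pow_eq_one
    refine ⟨R, iff_of_false (fun hinf => h ?_) h⟩
    rw [← T.placeValue_gen_infty hnF, T.placeValue_gen_eq_iff hnF, coord_infty, one_pow, hR] at hinf
    exact Nat.dvd_antisymm hn (T.isPrimitiveRoot_div.dvd_of_pow_eq_one _ hinf)

theorem evalCostLE_basisPoly {r : ℕ} {p : Fin r → ℕ} (μ : (i : Fin r) → Fin (p i - 1) → F)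
    (hp : ∀ i, (p i).Prime) {P : Finset F} {t : K}
    (hP : ∀ x ∈ P, T.coord (x : OnePoint F) ^ (∏ i, p i) = t) {C : ℝ}
    (hC : 3 * ((∏ i, p i : ℕ) : ℝ) * ∑ i, (p i : ℝ) ≤ C) :
    EvalCostLE (T.basisPoly p μ) P C := by
  classical
  have hn0 : 0 < ∏ i, p i := Finset.prod_pos fun i _ => (hp i).pos
  have hcount : ∀ m, m ∣ ∏ i, p i →
      m * (P.image fun x : F => T.coord (x : OnePoint F) ^ m).card ≤ ∏ i, p i :=
    fun m hm => mul_card_image_pow_le hn0 hm hP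
  refine evalCostLE_of_tower (Equiv.refl _) _ _
    (fun (j : Fin r) (x : F) => T.coord (x : OnePoint F) ^ partialProd p j)
    (fun i e (x : F) => T.levelFactor (partialProd p i) (μ i) e x)
    (fun x : F => ∏ i : Fin r, T.levelScale (partialProd p i) (p i) x) _ ?_ ?_ ?_
    (fun j => hcount _ (partialProd_dvd p j)) ?_ (fun i => (hp i).two_le) hC
  · intro e x _
    rw [basisPoly, eval_prod, ← Finset.prod_mul_distrib]
    exact Finset.prod_congr rfl fun i _ => T.eval_levelPoly _ _ (e i).2 x
  · intro hr x _
    subst hr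
    rfl
  · intro i j hij x _ y _ h e
    obtain ⟨k, hk⟩ := partialProd_dvd_partialProd p hij
    refine T.levelFactor_congr _ _ _ ?_
    rw [hk, pow_mul, pow_mul, h]
  · have h := hcount 1 (one_dvd _)
    simp only [pow_one, one_mul] at h
    rwa [Finset.card_image_of_injective] at h
    exact T.coord_injective.comp OnePoint.coe_injective

end PrimitivePair

theorem cyclic_case {F : Type*} [Field F] [Fintype F] {B : ℝ} {n : ℕ} (hB : 0 < B)
    (hn : IsSmooth B n) (hq : n ∣ Fintype.card F + 1) :
    ∃ (r : ℕ) (p : Fin r → ℕ) (a b : F) (lam : (i : Fin r) → Fin (p i - 1) → F)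
      (bas : ((i : Fin r) → Fin (p i)) → F[X]) (Q : OnePoint F),
      (∀ i, (p i).Prime) ∧ ∏ i, p i = n ∧ IsPrimitiveQuadratic a b ∧
      IsPoleEnumeration a b p lam ∧ IsCyclicBasis a b p lam bas ∧ IsBasisDegreeLT n bas ∧
      (Q = OnePoint.infty ↔ n = Fintype.card F + 1) ∧
      (placesAbove (towerGen a b p r) Q).ncard = n ∧
      EvalCostLE bas (finitePoints (placesAbove (towerGen a b p r) Q))
        (5 * (B * n * Real.log n)) := by
  classical
  obtain ⟨r, p, hp, hpn⟩ := exists_prime_family hn.1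
  obtain ⟨K, _, _, T, hT⟩ := exists_primitivePair F
  have hn0 : 0 < n := Nat.pos_of_ne_zero hn.1
  have hdvd : ∀ i, partialProd p i ∣ Fintype.card F + 1 := fun i =>
    (partialProd_dvd p i).trans (hpn ▸ hq)
  have hpdvd : ∀ i, p i ∣ Fintype.card F + 1 := fun i =>
    (Finset.dvd_prod_of_mem p (Finset.mem_univ i)).trans (hpn ▸ hq)
  have hm : ∀ i, (partialProd p i : F) ≠ 0 := fun i => PrimitivePair.cast_ne_zero (hdvd i)
  have hpF : ∀ i, (p i : F) ≠ 0 := fun i => PrimitivePair.cast_ne_zero (hpdvd i)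
  have hgen := T.towerGen_eq hp (hpn ▸ hq)
  have hnF := PrimitivePair.cast_ne_zero hq
  have hlast : towerGen T.a T.b p r = RatFunc.C (n : F) * T.gen n := by
    rw [hgen, partialProd_last, hpn]
  choose μ hinj hμ using fun i => T.exists_E_eq_prod (hp i).pos (hpdvd i)
  obtain ⟨R, hR⟩ := T.exists_split_place hq
  have hplaces : placesAbove (towerGen T.a T.b p r)
      (placeValue (RatFunc.C (n : F) * T.gen n) R) =
      {R' | T.coord R' ^ n = T.coord R ^ n} := by
    ext R'
    rw [hlast]
    exact T.placeValue_gen_eq_iff hnF R' R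
  refine ⟨r, p, T.a, T.b, fun i j => (partialProd p i : F) * μ i j, T.basisPoly p μ,
    placeValue (RatFunc.C (n : F) * T.gen n) R, hp, hpn, hT, fun i => ⟨?_, ?_⟩, fun e => ?_,
    hpn ▸ T.isBasisDegreeLT_basisPoly μ hp fun i => hm i, hR, ?_, ?_⟩
  · exact (mul_right_injective₀ (hm i)).comp (hinj i)
  · obtain ⟨u, h1, h2, h3⟩ := T.exists_gen_mul_eq (hm i) (hpF i) (hμ i)
    refine ⟨u, h1, h2, ?_⟩
    rw [hgen, hgen, partialProd_succ]
    exact h3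
  · have hden : (towerGen T.a T.b p r).denom =
        ∏ i : Fin r, ∏ j, T.shiftH (partialProd p i) (μ i j) := by
      rw [hgen, (T.num_denom_C_mul_gen (hm r)).2]
      refine prod_telescope (fun i => T.monicE (partialProd p i)) _ ?_ fun i => ?_
      · simp [partialProd_zero, PrimitivePair.monicE, PrimitivePair.E]
      · rw [partialProd_succ]
        exact T.monicE_mul (hm i) (hpF i) (hμ i)
    rw [hden, PrimitivePair.basisPoly, map_prod, map_prod, ← Finset.prod_mul_distrib]
    refine Finset.prod_congr rfl fun i _ => ?_
    rw [← T.prod_shiftH_mul_inv (hm i) (μ i) (e i).2, poleProd, hgen]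
  · rw [hplaces]
    exact T.ncard_coord_pow_eq hn0 hq R
  · refine T.evalCostLE_basisPoly μ hp (t := T.coord R ^ n) (fun x hx => ?_) ?_
    · rw [hplaces] at hx
      rw [hpn]
      simpa [finitePoints] using hx
    · rw [hpn]
      exact cost_le hB hn hp hpn

end GFFT

theorem theorem1p1 :
    ∃ K : ℝ, 0 < K ∧
      ∀ (F : Type*) [Field F] [Fintype F] (B : ℝ) (n : ℕ), 0 < B → GFFT.IsSmooth B n →
        -- multiplicative case: the standard basis, evaluated at a coset of the roots of unity
        (n ∣ Fintype.card F - 1 →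
          GFFT.IsBasisDegreeLT n (fun i : Fin n => (X ^ (i : ℕ) : F[X])) ∧
          ∀ β : F, β ≠ 0 →
            (GFFT.rootCoset F n β).card = n ∧
            GFFT.EvalCostLE (fun i : Fin n => (X ^ (i : ℕ) : F[X])) (GFFT.rootCoset F n β)
              (K * (B * n * Real.log n))) ∧
        -- additive case: products of linearized polynomials, evaluated at a coset of a subspace
        (n ∣ Fintype.card F →
          ∃ (r : ℕ) (W : Fin (r + 1) → AddSubgroup F),
            n = ringChar F ^ r ∧ GFFT.IsAddChain W ∧
            GFFT.IsBasisDegreeLT n (GFFT.addBasis W) ∧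
            ∀ γ : F,
              (GFFT.addCoset (W (Fin.last r)) γ).card = n ∧
              GFFT.EvalCostLE (GFFT.addBasis W) (GFFT.addCoset (W (Fin.last r)) γ)
                (K * (B * n * Real.log n))) ∧
        -- cyclic subgroup of order dividing `q + 1`, evaluated at the places above a
        -- rational place `Q` of the fixed field that splits completely
        (n ∣ Fintype.card F + 1 →
          ∃ (r : ℕ) (p : Fin r → ℕ) (a b : F) (lam : (i : Fin r) → Fin (p i - 1) → F)
            (bas : ((i : Fin r) → Fin (p i)) → F[X]) (Q : OnePoint F),
            (∀ i, (p i).Prime) ∧ ∏ i, p i = n ∧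
            GFFT.IsPrimitiveQuadratic a b ∧
            GFFT.IsPoleEnumeration a b p lam ∧
            GFFT.IsCyclicBasis a b p lam bas ∧
            GFFT.IsBasisDegreeLT n bas ∧
            (Q = OnePoint.infty ↔ n = Fintype.card F + 1) ∧
            (GFFT.placesAbove (GFFT.towerGen a b p r) Q).ncard = n ∧
            GFFT.EvalCostLE bas
              (GFFT.finitePoints (GFFT.placesAbove (GFFT.towerGen a b p r) Q))
              (K * (B * n * Real.log n))) := by
  refine ⟨5, by norm_num, fun F _ _ B n hB hn => ⟨fun hq => ?_, fun hq => ?_, fun hq => ?_⟩⟩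
  · obtain ⟨h1, h2⟩ := GFFT.multiplicative_case (F := F) hB hn
    exact ⟨h1, fun β hβ => ⟨GFFT.card_rootCoset (Nat.pos_of_ne_zero hn.1) hq hβ, h2 β⟩⟩
  · exact GFFT.additive_case hB hn hq
  · exact GFFT.cyclic_case hB hn hq
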